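/- Let $G\subset\mathbb C$ be a bounded simply connected domain with boundary $\Gamma=\partial G$. Suppose that $\Gamma$ contains an analytic arc $\Upsilon$ (that is, $\Upsilon$ is a homeomorphic image of the open interval $(0,1)$ under a real-analytic map with nowhere vanishing derivative) none of whose points is a cluster point of $\Gamma\setminus\Upsilon$. Let $\tau\in[0,1)$ and $\mathcal L_\tau=\overline\partial\,\partial_\tau$, where $\partial_\tau=\overline\partial+\tau\partial$, $\overline\partial=\frac12(\partial_x+i\partial_y)$ and $\partial=\frac12(\partial_x-i\partial_y)$. For a continuous function $\psi:\Gamma\to\mathbb C$, call the $\mathcal L_\tau$-Dirichlet problem in $G$ with boundary function $\psi$ solvable if there is a continuous function $f:\overline G\to\mathbb C$ that is of class $C^2$ in $G$, satisfies $\mathcal L_\tau f=0$ in $G$ and has $f|_\Gamma=\psi$; call $G$ $\mathcal L_\tau$-regular if this problem is solvable for every continuous $\psi:\Gamma\to\mathbb C$. Then $G$ is not $\mathcal L_\tau$-regular. Moreover, there is an open set $V\supset\Upsilon$ such that for every $a\in G\cap V$ the $\mathcal L_\tau$-Dirichlet problem in $G$ with boundary function $\psi(z)=1/(z-a)$ is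 not solvable. -/

import Mathlib

open Set Filter Topology

/-- The Cauchy–Riemann operator `∂̄ = (∂ₓ + i ∂ᵧ) / 2`. -/
noncomputable def dbar (f : ℂ → ℂ) (z : ℂ) : ℂ :=
  (1 / 2 : ℂ) * (fderiv ℝ f z 1 + Complex.I * fderiv ℝ f z Complex.I)

/-- The conjugate Cauchy–Riemann operator `∂ = (∂ₓ - i ∂ᵧ) / 2`. -/
noncomputable def del (f : ℂ → ℂ) (z : ℂ) : ℂ :=
  (1 / 2 : ℂ) * (fderiv ℝ f z 1 - Complex.I * fderiv ℝ f z Complex.I)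

/-- The first-order operator `∂_τ = ∂̄ + τ ∂`. -/
noncomputable def delTau (τ : ℂ) (f : ℂ → ℂ) (z : ℂ) : ℂ :=
  dbar f z + τ * del f z

/-- The second-order operator `𝓛_τ = ∂̄ ∂_τ`. -/
noncomputable def LTau (τ : ℂ) (f : ℂ → ℂ) : ℂ → ℂ :=
  dbar (delTau τ f)

/-- `f` is a classical (twice continuously differentiable) solution on `U` of `L f = 0`,
for a second-order differential operator `L`. -/
def IsLAnalyticOn (L : (ℂ → ℂ) → ℂ → ℂ) (f : ℂ → ℂ) (U : Set ℂ) : Prop :=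
  ContDiffOn ℝ 2 f U ∧ ∀ z ∈ U, L f z = 0

/-- The `L`-Dirichlet problem in `G` with boundary function `ψ` is solvable: some function
continuous on the closure of `G` and `L`-analytic in `G` agrees with `ψ` on the boundary. -/
def DirichletSolvable (L : (ℂ → ℂ) → ℂ → ℂ) (G : Set ℂ) (ψ : ℂ → ℂ) : Prop :=
  ∃ f : ℂ → ℂ, ContinuousOn f (closure G) ∧ IsLAnalyticOn L f G ∧
    ∀ z ∈ frontier G, f z = ψ z

/-- `G` is `L`-regular: the `L`-Dirichlet problem in `G` is solvable for every continuous
boundary function. -/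
def IsLRegular (L : (ℂ → ℂ) → ℂ → ℂ) (G : Set ℂ) : Prop :=
  ∀ ψ : ℂ → ℂ, ContinuousOn ψ (frontier G) → DirichletSolvable L G ψ

/-- `A` is an (open) analytic arc: the homeomorphic image of an open interval under a
real-analytic map whose derivative has no zeros. -/
def IsAnalyticArc (A : Set ℂ) : Prop :=
  ∃ γ : ℝ → ℂ, AnalyticOnNhd ℝ γ (Ioo 0 1) ∧ (∀ t ∈ Ioo (0 : ℝ) 1, deriv γ t ≠ 0) ∧
    IsEmbedding ((Ioo (0 : ℝ) 1).domRestrict γ) ∧ γ '' Ioo 0 1 = A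

open scoped ComplexConjugate

/-! A solution `f` would have, near the arc, the boundary values of a holomorphic function, and 1/(z
- a) with its pole on the solution's side does not allow this.

The two factors of the operator commute, so ∂_τ kills q = ∂̄f, and q is holomorphic in u = z - τz̄.
Take a conformal chart Γ carrying a real interval to the arc. If Q' = q in the variable u, then f +
τ⁻¹Q(z - τz̄) is holomorphic in z. Replacing z̄ on the arc by its holomorphic reflection conj Γ(w̄)
and subtracting τ⁻¹Q(Γ(w) - τ conj Γ(w̄)) gives a holomorphic F(w) that equals f ∘ Γ for real w.
Written as an integral of q along a segment (`reflExt`), F also makes sense for τ = 0.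

Two facts make this work up to the boundary. The segment stays in the domain, at distance comparable
to Im w from its complement (`exists_closedBall_reflSegment_subset`). Moreover |q| ≤ 2 osc(f)/R on
ellipses of size R (`IsLAnalyticOn.norm_dbar_mul_le`). The correction F - f ∘ Γ is thus bounded by
an oscillation of f, which tends to 0. Then F(w)(Γ(w) - a) - 1 vanishes on the diameter of a half
disc, hence throughout it (`eqOn_zero_of_continuousOn_halfDisc`), yet equals -1 where Γ(w) = a. -/

/-! ### Wirtinger calculus and commutation of the factors -/

lemma fderiv_eq_del_mul_add_dbar_mul_conj (f : ℂ → ℂ) (z v : ℂ) :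
    fderiv ℝ f z v = del f z * v + dbar f z * conj v := by
  have hv : v = v.re • (1 : ℂ) + v.im • Complex.I := by
    simp [Complex.re_add_im]
  have h1 : fderiv ℝ f z v = v.re * fderiv ℝ f z 1 + v.im * fderiv ℝ f z Complex.I := by
    conv_lhs => rw [hv]
    rw [map_add, map_smul, map_smul]; simp
  have hc : conj v = v.re - v.im * Complex.I := by
    apply Complex.ext <;> simp
  have hv' : v = v.re + v.im * Complex.I := (Complex.re_add_im v).symm
  rw [h1, del, dbar, hc]
  generalize fderiv ℝ f z 1 = A
  generalize fderiv ℝ f z Complex.I = B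
  generalize hx : (v.re : ℂ) = x at *
  generalize hy : (v.im : ℂ) = y at *
  rw [hv']
  linear_combination (y * B) * Complex.I_sq

/-- A real-linear map of `ℂ` written as `v ↦ α v + β v̄` determines `∂` and `∂̄`. -/
lemma HasFDerivAt.dbar_eq {f : ℂ → ℂ} {L : ℂ →L[ℝ] ℂ} {z : ℂ} (h : HasFDerivAt f L z) :
    dbar f z = (1 / 2 : ℂ) * (L 1 + Complex.I * L Complex.I) := by
  rw [dbar, h.fderiv]

lemma HasFDerivAt.del_eq {f : ℂ → ℂ} {L : ℂ →L[ℝ] ℂ} {z : ℂ} (h : HasFDerivAt f L z) :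
    del f z = (1 / 2 : ℂ) * (L 1 - Complex.I * L Complex.I) := by
  rw [del, h.fderiv]

/-- A real-differentiable function whose derivative is multiplication by a complex number is
complex differentiable. -/
lemma HasFDerivAt.hasDerivAt_of_forall_eq_mul {f : ℂ → ℂ} {L : ℂ →L[ℝ] ℂ} {z c : ℂ}
    (h : HasFDerivAt f L z) (hL : ∀ v, L v = c * v) : HasDerivAt f c z := by
  rw [hasDerivAt_iff_hasFDerivAt]
  refine hasFDerivAt_of_restrictScalars ℝ h ?_
  ext <;> simp [hL, mul_comm]

lemma ContDiffAt.hasFDerivAt_fderiv {f : ℂ → ℂ} {z : ℂ} (hf : ContDiffAt ℝ 2 f z) :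
    HasFDerivAt (fderiv ℝ f) (fderiv ℝ (fderiv ℝ f) z) z :=
  ((hf.fderiv_right (m := 1) (by norm_num)).differentiableAt (by norm_num)).hasFDerivAt

lemma ContDiffAt.hasFDerivAt_dbar {f : ℂ → ℂ} {z : ℂ} (hf : ContDiffAt ℝ 2 f z) :
    HasFDerivAt (dbar f) ((1 / 2 : ℂ) • ((fderiv ℝ (fderiv ℝ f) z).flip 1 +
      Complex.I • (fderiv ℝ (fderiv ℝ f) z).flip Complex.I)) z := by
  have h := hf.hasFDerivAt_fderiv
  have h1 := h.clm_apply (hasFDerivAt_const (1 : ℂ) z)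
  have h2 := h.clm_apply (hasFDerivAt_const Complex.I z)
  refine ((h1.add (h2.const_mul Complex.I)).const_mul (1 / 2 : ℂ)).congr_fderiv ?_
  ext v
  simp

lemma ContDiffAt.hasFDerivAt_del {f : ℂ → ℂ} {z : ℂ} (hf : ContDiffAt ℝ 2 f z) :
    HasFDerivAt (del f) ((1 / 2 : ℂ) • ((fderiv ℝ (fderiv ℝ f) z).flip 1 -
      Complex.I • (fderiv ℝ (fderiv ℝ f) z).flip Complex.I)) z := by
  have h := hf.hasFDerivAt_fderiv
  have h1 := h.clm_apply (hasFDerivAt_const (1 : ℂ) z)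
  have h2 := h.clm_apply (hasFDerivAt_const Complex.I z)
  refine ((h1.sub (h2.const_mul Complex.I)).const_mul (1 / 2 : ℂ)).congr_fderiv ?_
  ext v
  simp

/-- Symmetry of the second derivative. This order of the factors gives a first-order equation for
∂̄f. -/
lemma LTau_eq_delTau_dbar {f : ℂ → ℂ} {z : ℂ} (τ : ℂ) (hf : ContDiffAt ℝ 2 f z) :
    LTau τ f z = delTau τ (dbar f) z := by
  have hs : fderiv ℝ (fderiv ℝ f) z 1 Complex.I = fderiv ℝ (fderiv ℝ f) z Complex.I 1 :=
    (hf.isSymmSndFDerivAt (by simp)).eq 1 Complex.I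
  have h : HasFDerivAt (delTau τ f) _ z := hf.hasFDerivAt_dbar.add (hf.hasFDerivAt_del.const_mul τ)
  rw [LTau, h.dbar_eq, delTau, hf.hasFDerivAt_dbar.dbar_eq, hf.hasFDerivAt_dbar.del_eq]
  simp [hs]
  ring

/-! ### The change of variable u = z - τz̄ -/

/-- The linear map `z ↦ z - τ z̄`, in whose variable the kernel of `∂_τ` is holomorphic. -/
noncomputable def skew (τ : ℝ) : ℂ →L[ℝ] ℂ :=
  ContinuousLinearMap.id ℝ ℂ - τ • (Complex.conjCLE : ℂ →L[ℝ] ℂ)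

/-- The inverse of `skew τ`. -/
noncomputable def skewInv (τ : ℝ) : ℂ →L[ℝ] ℂ :=
  (1 - τ ^ 2)⁻¹ • (ContinuousLinearMap.id ℝ ℂ + τ • (Complex.conjCLE : ℂ →L[ℝ] ℂ))

lemma skew_apply (τ : ℝ) (z : ℂ) : skew τ z = z - τ * conj z := by
  simp [skew]

lemma skewInv_apply (τ : ℝ) (z : ℂ) : skewInv τ z = (1 - (τ : ℂ) ^ 2)⁻¹ * (z + τ * conj z) := by
  simp [skewInv, mul_add]

lemma one_sub_sq_ne_zero_of_mem_Ico {τ : ℝ} (hτ : τ ∈ Ico (0 : ℝ) 1) : 1 - (τ : ℂ) ^ 2 ≠ 0 := by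
  have : (1 : ℝ) - τ ^ 2 ≠ 0 := by nlinarith [hτ.1, hτ.2]
  exact_mod_cast this

lemma skew_skewInv {τ : ℝ} (hτ : τ ∈ Ico (0 : ℝ) 1) (z : ℂ) : skew τ (skewInv τ z) = z := by
  have := one_sub_sq_ne_zero_of_mem_Ico hτ
  simp only [skew_apply, skewInv_apply, map_mul, map_add, map_inv₀, map_sub, map_pow, map_one,
    Complex.conj_ofReal, Complex.conj_conj]
  field_simp
  ring

lemma skewInv_skew {τ : ℝ} (hτ : τ ∈ Ico (0 : ℝ) 1) (z : ℂ) : skewInv τ (skew τ z) = z := by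
  have := one_sub_sq_ne_zero_of_mem_Ico hτ
  simp only [skew_apply, skewInv_apply, map_mul, map_sub, Complex.conj_ofReal, Complex.conj_conj]
  field_simp
  ring

lemma norm_skewInv_le {τ : ℝ} (hτ : τ ∈ Ico (0 : ℝ) 1) (z : ℂ) :
    ‖skewInv τ z‖ ≤ (1 - τ)⁻¹ * ‖z‖ := by
  obtain ⟨h0, h1⟩ := hτ
  have h2 : (1 - (τ : ℂ) ^ 2) = ((1 - τ ^ 2 : ℝ) : ℂ) := by push_cast; ring
  have h3 : 0 < 1 - τ ^ 2 := by nlinarith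
  rw [skewInv_apply, norm_mul, norm_inv, h2, Complex.norm_of_nonneg h3.le]
  have h4 : ‖z + τ * conj z‖ ≤ (1 + τ) * ‖z‖ := by
    refine (norm_add_le _ _).trans ?_
    rw [norm_mul, Complex.norm_of_nonneg h0, RCLike.norm_conj]
    linarith
  calc _ ≤ (1 - τ ^ 2)⁻¹ * ((1 + τ) * ‖z‖) := by gcongr
    _ = _ := by
      have : 1 - τ ≠ 0 := by linarith
      have : 1 + τ ≠ 0 := by linarith
      rw [show 1 - τ ^ 2 = (1 - τ) * (1 + τ) by ring]
      field_simp

/-- For a solution `f`, the function `∂̄ f` is holomorphic in the variable `z - τ z̄`. -/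
lemma IsLAnalyticOn.differentiableAt_dbar_comp_skewInv {τ : ℝ} {f : ℂ → ℂ} {G : Set ℂ}
    (hG : IsOpen G) (hf : IsLAnalyticOn (LTau τ) f G) {u : ℂ} (hu : skewInv τ u ∈ G) :
    DifferentiableAt ℂ (fun u => dbar f (skewInv τ u)) u := by
  have hfz : ContDiffAt ℝ 2 f (skewInv τ u) := hf.1.contDiffAt (hG.mem_nhds hu)
  have h0 : delTau τ (dbar f) (skewInv τ u) = 0 := by
    rw [← LTau_eq_delTau_dbar _ hfz]; exact hf.2 _ hu
  have hd : HasFDerivAt (dbar f) (fderiv ℝ (dbar f) (skewInv τ u)) (skewInv τ u) :=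
    hfz.hasFDerivAt_dbar.differentiableAt.hasFDerivAt
  have hc := hd.comp u (skewInv τ).hasFDerivAt
  -- With g = ∂̄f, the coefficient of v̄ is a multiple of ∂̄g + τ∂g = 0; the coefficient of v is the
  -- complex derivative.
  refine (hc.hasDerivAt_of_forall_eq_mul (c := (1 - (τ : ℂ) ^ 2)⁻¹ *
    (del (dbar f) (skewInv τ u) + τ * dbar (dbar f) (skewInv τ u))) fun v => ?_).differentiableAt
  rw [ContinuousLinearMap.comp_apply, fderiv_eq_del_mul_add_dbar_mul_conj]
  rw [delTau] at h0
  simp only [skewInv_apply] at *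
  simp only [map_mul, map_add, map_inv₀, map_sub, map_pow, map_one,
    Complex.conj_ofReal, Complex.conj_conj]
  linear_combination (1 - (τ : ℂ) ^ 2)⁻¹ * conj v * h0

/-! ### Green's formula on ellipses and the gradient estimate -/

lemma hasFDerivAt_comp_skewInv_polar {f : ℂ → ℂ} (τ : ℝ) (u₀ : ℂ) (x : ℝ × ℝ)
    (hf : DifferentiableAt ℝ f (skewInv τ (circleMap u₀ x.1 x.2))) :
    HasFDerivAt (fun x : ℝ × ℝ => f (skewInv τ (circleMap u₀ x.1 x.2)))
      ((fderiv ℝ f (skewInv τ (circleMap u₀ x.1 x.2))).comp ((skewInv τ).comp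
        ((ContinuousLinearMap.fst ℝ ℝ ℝ).smulRight (Complex.exp (x.2 * Complex.I)) +
          (x.1 : ℝ) • (ContinuousLinearMap.snd ℝ ℝ ℝ).smulRight
            (Complex.I * Complex.exp (x.2 * Complex.I))))) x := by
  have he : HasFDerivAt (fun x : ℝ × ℝ => Complex.exp (x.2 * Complex.I))
      ((ContinuousLinearMap.snd ℝ ℝ ℝ).smulRight (Complex.I * Complex.exp (x.2 * Complex.I))) x := by
    have h1 : HasDerivAt (fun t : ℝ => Complex.exp (t * Complex.I))
        (Complex.I * Complex.exp (x.2 * Complex.I)) x.2 := by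
      have := ((hasDerivAt_id (x.2 : ℂ)).mul_const Complex.I).cexp.comp_ofReal
      simpa [mul_comm] using this
    exact (h1.hasFDerivAt.comp x hasFDerivAt_snd).congr_fderiv (by ext <;> simp)
  have hc : HasFDerivAt (fun x : ℝ × ℝ => circleMap u₀ x.1 x.2)
      ((ContinuousLinearMap.fst ℝ ℝ ℝ).smulRight (Complex.exp (x.2 * Complex.I)) +
          (x.1 : ℝ) • (ContinuousLinearMap.snd ℝ ℝ ℝ).smulRight
            (Complex.I * Complex.exp (x.2 * Complex.I))) x := by
    have h2 : (fun x : ℝ × ℝ => circleMap u₀ x.1 x.2) =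
        fun x : ℝ × ℝ => u₀ + x.1 • Complex.exp (x.2 * Complex.I) := by
      ext x; simp [circleMap]
    rw [h2]
    refine ((hasFDerivAt_fst.smul he).const_add u₀).congr_fderiv ?_
    ext <;> simp
  exact hf.hasFDerivAt.comp x ((skewInv τ).hasFDerivAt.comp x hc)

/-- This is 2i times the Jacobian 1/(1 - τ²) of `skewInv τ`, evaluated on the orthonormal frame e,
ie. -/
lemma conj_mul_sub_conj_mul_skewInv {τ : ℝ} (hτ : τ ∈ Ico (0 : ℝ) 1) {e : ℂ}
    (he : e * conj e = 1) :
    conj (skewInv τ e) * skewInv τ (Complex.I * e) -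
      conj (skewInv τ (Complex.I * e)) * skewInv τ e = 2 * Complex.I / (1 - (τ : ℂ) ^ 2) := by
  have := one_sub_sq_ne_zero_of_mem_Ico hτ
  simp only [skewInv_apply, map_mul, map_add, map_inv₀, map_sub, map_pow, map_one,
    Complex.conj_ofReal, Complex.conj_conj, Complex.conj_I, map_neg]
  field_simp
  linear_combination (2 * (1 - (τ : ℂ) ^ 2)) * he

/-- Green's formula on the ellipse `skewInv τ '' closedBall u₀ R`. -/
lemma IsLAnalyticOn.integral_ellipse {τ : ℝ} (hτ : τ ∈ Ico (0 : ℝ) 1) {f : ℂ → ℂ} {G : Set ℂ}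
    (hG : IsOpen G) (hf : IsLAnalyticOn (LTau τ) f G) {u₀ : ℂ} {R : ℝ} (hR : 0 < R)
    (hball : ∀ u ∈ Metric.closedBall u₀ R, skewInv τ u ∈ G) :
    ∫ θ in (0 : ℝ)..2 * Real.pi, f (skewInv τ (circleMap u₀ R θ)) *
      (R * skewInv τ (Complex.I * Complex.exp (θ * Complex.I))) =
      2 * Real.pi * Complex.I * R ^ 2 / (1 - (τ : ℂ) ^ 2) * dbar f (skewInv τ u₀) := by
  have hmem : ∀ x : ℝ × ℝ, x ∈ Icc 0 R ×ˢ Icc (0 : ℝ) (2 * Real.pi) →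
      circleMap u₀ x.1 x.2 ∈ Metric.closedBall u₀ R := fun x hx =>
    Metric.closedBall_subset_closedBall hx.1.2 (circleMap_mem_closedBall u₀ hx.1.1 x.2)
  have hq : ∀ u ∈ Metric.closedBall u₀ R,
      DifferentiableAt ℂ (fun u => dbar f (skewInv τ u)) u := fun u hu =>
    hf.differentiableAt_dbar_comp_skewInv hG (hball u hu)
  have hfd : ∀ x : ℝ × ℝ, x ∈ Icc 0 R ×ˢ Icc (0 : ℝ) (2 * Real.pi) →
      DifferentiableAt ℝ f (skewInv τ (circleMap u₀ x.1 x.2)) := fun x hx =>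
    (hf.1.contDiffAt (hG.mem_nhds (hball _ (hmem x hx)))).differentiableAt (by norm_num)
  have hexp : ∀ (c : ℂ) (x : ℝ × ℝ),
      HasFDerivAt (fun x : ℝ × ℝ => skewInv τ (c * Complex.exp (x.2 * Complex.I)))
        ((ContinuousLinearMap.snd ℝ ℝ ℝ).smulRight
          (skewInv τ (c * (Complex.I * Complex.exp (x.2 * Complex.I))))) x := by
    intro c x
    have h1 : HasDerivAt (fun t : ℝ => c * Complex.exp (t * Complex.I))
        (c * (Complex.I * Complex.exp (x.2 * Complex.I))) x.2 := by
      have := (((hasDerivAt_id (x.2 : ℂ)).mul_const Complex.I).cexp.comp_ofReal).const_mul c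
      simpa [mul_comm] using this
    exact ((skewInv τ).hasFDerivAt.comp x (h1.hasFDerivAt.comp x hasFDerivAt_snd)).congr_fderiv
      (by ext <;> simp)
  -- In polar coordinates the form f dz corresponds to the field (f z_θ, -f z_ρ). In its divergence
  -- the mixed derivatives of z cancel, as do the ∂f terms.
  have h1 : ∀ x : ℝ × ℝ, x ∈ Icc 0 R ×ˢ Icc (0 : ℝ) (2 * Real.pi) → ∃ L : ℝ × ℝ →L[ℝ] ℂ,
      HasFDerivAt (fun x : ℝ × ℝ => f (skewInv τ (circleMap u₀ x.1 x.2)) *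
        (x.1 • skewInv τ (Complex.I * Complex.exp (x.2 * Complex.I)))) L x ∧
      L (1, 0) = f (skewInv τ (circleMap u₀ x.1 x.2)) *
          skewInv τ (Complex.I * Complex.exp (x.2 * Complex.I)) +
        x.1 * skewInv τ (Complex.I * Complex.exp (x.2 * Complex.I)) *
          fderiv ℝ f (skewInv τ (circleMap u₀ x.1 x.2))
            (skewInv τ (Complex.exp (x.2 * Complex.I))) := fun x hx =>
    ⟨_, (hasFDerivAt_comp_skewInv_polar τ u₀ x (hfd x hx)).mul
      ((hasFDerivAt_fst (𝕜 := ℝ) (p := x)).smul (hexp Complex.I x)), by simp⟩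
  have h2 : ∀ x : ℝ × ℝ, x ∈ Icc 0 R ×ˢ Icc (0 : ℝ) (2 * Real.pi) → ∃ L : ℝ × ℝ →L[ℝ] ℂ,
      HasFDerivAt (fun x : ℝ × ℝ => -(f (skewInv τ (circleMap u₀ x.1 x.2)) *
        skewInv τ (1 * Complex.exp (x.2 * Complex.I)))) L x ∧
      L (0, 1) = -(f (skewInv τ (circleMap u₀ x.1 x.2)) *
          skewInv τ (Complex.I * Complex.exp (x.2 * Complex.I)) +
        skewInv τ (Complex.exp (x.2 * Complex.I)) *
          (x.1 * fderiv ℝ f (skewInv τ (circleMap u₀ x.1 x.2))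
            (skewInv τ (Complex.I * Complex.exp (x.2 * Complex.I))))) := fun x hx =>
    ⟨_, ((hasFDerivAt_comp_skewInv_polar τ u₀ x (hfd x hx)).mul (hexp 1 x)).neg, by simp⟩
  choose! A hA hA' using h1
  choose! B hB hB' using h2
  have hAB : ∀ x : ℝ × ℝ, x ∈ Icc 0 R ×ˢ Icc (0 : ℝ) (2 * Real.pi) →
      A x (1, 0) + B x (0, 1) = 2 * Complex.I / (1 - (τ : ℂ) ^ 2) * x.1 *
        dbar f (skewInv τ (circleMap u₀ x.1 x.2)) := by
    intro x hx
    have he : Complex.exp (x.2 * Complex.I) * conj (Complex.exp (x.2 * Complex.I)) = 1 := by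
      rw [Complex.mul_conj, Complex.normSq_eq_norm_sq, Complex.norm_exp_ofReal_mul_I]; simp
    rw [hA' x hx, hB' x hx, fderiv_eq_del_mul_add_dbar_mul_conj f _ (skewInv τ (Complex.exp _)),
      fderiv_eq_del_mul_add_dbar_mul_conj f _ (skewInv τ (Complex.I * _)),
      ← conj_mul_sub_conj_mul_skewInv hτ he]
    ring
  have hS : uIcc 0 R ×ˢ uIcc 0 (2 * Real.pi) = Icc 0 R ×ˢ Icc (0 : ℝ) (2 * Real.pi) := by
    rw [uIcc_of_le hR.le, uIcc_of_le Real.two_pi_pos.le]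
  have hS' : Ioo (min 0 R) (max 0 R) ×ˢ Ioo (min 0 (2 * Real.pi)) (max 0 (2 * Real.pi)) ⊆
      Icc 0 R ×ˢ Icc (0 : ℝ) (2 * Real.pi) := by
    rw [min_eq_left hR.le, max_eq_right hR.le, min_eq_left Real.two_pi_pos.le,
      max_eq_right Real.two_pi_pos.le]
    exact prod_mono Ioo_subset_Icc_self Ioo_subset_Icc_self
  have hcont : ContinuousOn (fun x : ℝ × ℝ => 2 * Complex.I / (1 - (τ : ℂ) ^ 2) * x.1 *
        dbar f (skewInv τ (circleMap u₀ x.1 x.2))) (Icc 0 R ×ˢ Icc (0 : ℝ) (2 * Real.pi)) := by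
    refine ContinuousOn.mul (by fun_prop) ?_
    have hq' : ContinuousOn (fun u => dbar f (skewInv τ u)) (Metric.closedBall u₀ R) :=
      fun u hu => (hq u hu).continuousAt.continuousWithinAt
    refine hq'.comp (f := fun x : ℝ × ℝ => circleMap u₀ x.1 x.2) ?_ hmem
    simp only [circleMap]
    fun_prop
  have key := MeasureTheory.integral2_divergence_prod_of_hasFDerivAt _ _ A B 0 0 R (2 * Real.pi)
    (fun x hx => (hA x (hS ▸ hx)).continuousAt.continuousWithinAt)
    (fun x hx => (hB x (hS ▸ hx)).continuousAt.continuousWithinAt)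
    (fun x hx => hA x (hS' hx)) (fun x hx => hB x (hS' hx))
    (by
      rw [hS]
      refine (hcont.integrableOn_compact (isCompact_Icc.prod isCompact_Icc)).congr_fun
        (fun x hx => (hAB x hx).symm) (measurableSet_Icc.prod measurableSet_Icc))
  -- The mean value property of ∂̄f in the variable u turns the area integral into the value at the
  -- centre. Of the boundary terms, ρ = 0 vanishes and θ = 0, 2π cancel by periodicity.
  have hmean : ∀ ρ ∈ Icc 0 R, ∫ θ in (0 : ℝ)..2 * Real.pi, A (ρ, θ) (1, 0) + B (ρ, θ) (0, 1) =
      2 * Complex.I / (1 - (τ : ℂ) ^ 2) * ρ * (2 * Real.pi * dbar f (skewInv τ u₀)) := by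
    intro ρ hρ
    have hd : DiffContOnCl ℂ (fun u => dbar f (skewInv τ u)) (Metric.ball u₀ |ρ|) := by
      rw [abs_of_nonneg hρ.1]
      refine DifferentiableOn.diffContOnCl fun u hu => (hq u ?_).differentiableWithinAt
      exact Metric.closedBall_subset_closedBall hρ.2 (Metric.closure_ball_subset_closedBall hu)
    have hm := hd.circleAverage
    rw [Real.circleAverage, inv_smul_eq_iff₀ Real.two_pi_pos.ne'] at hm
    rw [intervalIntegral.integral_congr (g := fun θ => 2 * Complex.I / (1 - (τ : ℂ) ^ 2) * ρ *
        dbar f (skewInv τ (circleMap u₀ ρ θ))) fun θ hθ => hAB (ρ, θ)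
        ⟨hρ, by simpa [uIcc_of_le Real.two_pi_pos.le] using hθ⟩,
      intervalIntegral.integral_const_mul, hm]
    simp
  rw [intervalIntegral.integral_congr (g := fun ρ : ℝ => 2 * Complex.I / (1 - (τ : ℂ) ^ 2) * ρ *
    (2 * Real.pi * dbar f (skewInv τ u₀))) fun ρ hρ => hmean ρ (by
      simpa [uIcc_of_le hR.le] using hρ)] at key
  have hid : ∫ ρ in (0 : ℝ)..R, (ρ : ℂ) = (R : ℂ) ^ 2 / 2 := by
    have := intervalIntegral.integral_ofReal (a := 0) (b := R) (f := fun x => x) (μ := MeasureTheory.volume)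
    simp only [integral_id] at this
    simpa using this
  have hper : ∀ ρ : ℝ, circleMap u₀ ρ (2 * Real.pi) = circleMap u₀ ρ 0 := fun ρ => by
    simp [circleMap]
  simp only [intervalIntegral.integral_mul_const, intervalIntegral.integral_const_mul, hid] at key
  simp only [hper, zero_smul, mul_zero, intervalIntegral.integral_zero, sub_zero] at key
  have hexp2 : Complex.exp (((2 * Real.pi : ℝ) : ℂ) * Complex.I) = Complex.exp (((0 : ℝ) : ℂ) * Complex.I) := by
    simp
  rw [hexp2, sub_self, zero_add] at key
  simp only [Complex.real_smul] at key
  rw [← key]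
  ring

/-- Interior gradient estimate: on a solution, `∂̄ f` is bounded by the oscillation of `f`
divided by the radius. -/
lemma IsLAnalyticOn.norm_dbar_mul_le {τ : ℝ} (hτ : τ ∈ Ico (0 : ℝ) 1) {f : ℂ → ℂ} {G : Set ℂ}
    (hG : IsOpen G) (hf : IsLAnalyticOn (LTau τ) f G) {u₀ : ℂ} {R : ℝ} (hR : 0 < R)
    (hball : ∀ u ∈ Metric.closedBall u₀ R, skewInv τ u ∈ G) {κ : ℂ} {ε : ℝ}
    (hosc : ∀ u ∈ Metric.closedBall u₀ R, ‖f (skewInv τ u) - κ‖ ≤ ε) :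
    ‖dbar f (skewInv τ u₀)‖ * R ≤ 2 * ε := by
  have h1 := hf.integral_ellipse hτ hG hR hball
  -- A closed contour integral of κ dz is zero, so f may be replaced by f - κ.
  have hz : ∫ θ in (0 : ℝ)..2 * Real.pi, κ *
      (R * skewInv τ (Complex.I * Complex.exp (θ * Complex.I))) = 0 := by
    have hd : ∀ θ : ℝ, HasDerivAt (fun θ : ℝ => κ * (R * skewInv τ (Complex.exp (θ * Complex.I))))
        (κ * (R * skewInv τ (Complex.I * Complex.exp (θ * Complex.I)))) θ := by
      intro θ
      have h1 : HasDerivAt (fun t : ℝ => Complex.exp (t * Complex.I))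
          (Complex.I * Complex.exp (θ * Complex.I)) θ := by
        have := ((hasDerivAt_id (θ : ℂ)).mul_const Complex.I).cexp.comp_ofReal
        simpa [mul_comm] using this
      exact (((skewInv τ).hasFDerivAt.comp_hasDerivAt θ h1).const_mul (R : ℂ)).const_mul κ
    rw [intervalIntegral.integral_eq_sub_of_hasDerivAt (fun θ _ => hd θ)
      (Continuous.intervalIntegrable (by fun_prop) _ _)]
    simp
  have hcf : ContinuousOn (fun θ : ℝ => f (skewInv τ (circleMap u₀ R θ)) *
      (R * skewInv τ (Complex.I * Complex.exp (θ * Complex.I)))) (uIcc 0 (2 * Real.pi)) := by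
    refine ContinuousOn.mul ?_ (by fun_prop)
    refine hf.1.continuousOn.comp (f := fun θ => skewInv τ (circleMap u₀ R θ)) ?_ ?_
    · exact ((skewInv τ).continuous.comp (continuous_circleMap u₀ R)).continuousOn
    · exact fun θ _ => hball _ (circleMap_mem_closedBall u₀ hR.le θ)
  have h2 : ∫ θ in (0 : ℝ)..2 * Real.pi, (f (skewInv τ (circleMap u₀ R θ)) - κ) *
      (R * skewInv τ (Complex.I * Complex.exp (θ * Complex.I))) =
      2 * Real.pi * Complex.I * R ^ 2 / (1 - (τ : ℂ) ^ 2) * dbar f (skewInv τ u₀) := by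
    simp only [sub_mul]
    rw [intervalIntegral.integral_sub hcf.intervalIntegrable
      (Continuous.intervalIntegrable (by fun_prop) _ _), hz, sub_zero, h1]
  have h3 := intervalIntegral.norm_integral_le_of_norm_le_const (a := 0) (b := 2 * Real.pi)
    (f := fun θ : ℝ => (f (skewInv τ (circleMap u₀ R θ)) - κ) *
      (R * skewInv τ (Complex.I * Complex.exp (θ * Complex.I)))) (C := ε * (R * (1 - τ)⁻¹))
    fun θ _ => by
      have hε := hosc _ (circleMap_mem_closedBall u₀ hR.le θ)
      have hs := norm_skewInv_le hτ (Complex.I * Complex.exp (θ * Complex.I))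
      rw [norm_mul Complex.I, Complex.norm_exp_ofReal_mul_I, Complex.norm_I, mul_one, mul_one] at hs
      rw [norm_mul, norm_mul, Complex.norm_of_nonneg hR.le]
      have := (norm_nonneg _).trans hε
      gcongr
  obtain ⟨h0, h1'⟩ := hτ
  have e1 : 0 < 1 - τ := by linarith
  have e2 : 0 < 1 - τ ^ 2 := by nlinarith
  have e3 : (1 - (τ : ℂ) ^ 2) = ((1 - τ ^ 2 : ℝ) : ℂ) := by push_cast; ring
  have hε : 0 ≤ ε := (norm_nonneg _).trans (hosc u₀ (by simp [hR.le]))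
  rw [h2, e3] at h3
  simp only [norm_mul, norm_div, norm_pow, Complex.norm_I, Complex.norm_of_nonneg hR.le,
    Complex.norm_of_nonneg e2.le, Complex.norm_of_nonneg Real.pi_pos.le, Complex.norm_ofNat,
    sub_zero, abs_of_pos Real.two_pi_pos, mul_one] at h3
  -- After the common factor is cancelled the bound is (1 + τ)ε, at most 2ε.
  have e4 : 2 * Real.pi * R ^ 2 / (1 - τ ^ 2) * ‖dbar f (skewInv τ u₀)‖ =
      (‖dbar f (skewInv τ u₀)‖ * R) * (2 * Real.pi * R / (1 - τ ^ 2)) := by ring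
  have e5 : ε * (R * (1 - τ)⁻¹) * (2 * Real.pi) =
      (ε * (1 + τ)) * (2 * Real.pi * R / (1 - τ ^ 2)) := by
    have : 1 + τ ≠ 0 := by linarith
    rw [show 1 - τ ^ 2 = (1 - τ) * (1 + τ) by ring]
    field_simp
  rw [e4, e5] at h3
  have := le_of_mul_le_mul_right h3 (by positivity)
  nlinarith

/-! ### Boundary uniqueness on a half disc -/

/-- A holomorphic function on a half disc vanishing continuously on the diameter is zero. -/
lemma eqOn_zero_of_continuousOn_halfDisc {F : ℂ → ℂ} {r : ℝ} (hr : 0 < r)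
    (hd : DifferentiableOn ℂ F (Metric.ball 0 r ∩ {w | 0 < w.im}))
    (hc : ContinuousOn F (Metric.ball 0 r ∩ {w | 0 ≤ w.im}))
    (h0 : ∀ w ∈ Metric.ball (0 : ℂ) r, w.im = 0 → F w = 0) :
    ∀ w ∈ Metric.ball (0 : ℂ) r, 0 < w.im → F w = 0 := by
  have hopen : IsOpen (Metric.ball (0 : ℂ) r ∩ {w | 0 < w.im}) :=
    Metric.isOpen_ball.inter (isOpen_lt continuous_const Complex.continuous_im)
  -- The square centred at z with half-side Im z has its bottom side on the real axis. The product
  -- of F over the four quarter-turns about z vanishes on all sides, so the maximum principle gives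
  -- F(z)⁴ = 0. The bound r/4 keeps the square inside the disc.
  have hsmall : ∀ z : ℂ, ‖z‖ < r / 4 → 0 < z.im → F z = 0 := by
    intro z hz hy
    set y := z.im with hydef
    have hyle : y ≤ ‖z‖ := (le_abs_self _).trans (Complex.abs_im_le_norm z)
    let U : Set ℂ := {w | |(w - z).re| < y} ∩ {w | |(w - z).im| < y}
    let C : Set ℂ := {w | |(w - z).re| ≤ y} ∩ {w | |(w - z).im| ≤ y}
    have hUo : IsOpen U := by
      refine IsOpen.inter (isOpen_lt ?_ continuous_const) (isOpen_lt ?_ continuous_const)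
      · exact (Complex.continuous_re.comp (continuous_id.sub continuous_const)).abs
      · exact (Complex.continuous_im.comp (continuous_id.sub continuous_const)).abs
    have hCc : IsClosed C := by
      refine IsClosed.inter (isClosed_le ?_ continuous_const) (isClosed_le ?_ continuous_const)
      · exact (Complex.continuous_re.comp (continuous_id.sub continuous_const)).abs
      · exact (Complex.continuous_im.comp (continuous_id.sub continuous_const)).abs
    have hC₁ : ∀ w ∈ C, |(w - z).re| ≤ y := fun w hw => hw.1
    have hC₂ : ∀ w ∈ C, |(w - z).im| ≤ y := fun w hw => hw.2
    have hU₂ : ∀ w ∈ U, |(w - z).im| < y := fun w hw => hw.2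
    have hUsub : U ⊆ C := fun w hw =>
      ⟨show |(w - z).re| ≤ y from le_of_lt hw.1, show |(w - z).im| ≤ y from le_of_lt hw.2⟩
    have hUC : closure U ⊆ C :=
      closure_minimal hUsub hCc
    have hCn : ∀ w ∈ C, ‖w - z‖ ≤ 2 * y := fun w hw =>
      (Complex.norm_le_abs_re_add_abs_im _).trans (by linarith [hC₁ w hw, hC₂ w hw])
    have hrotC : ∀ w ∈ C, ∀ k : ℕ, z + Complex.I ^ k * (w - z) ∈ C := by
      intro w hw k
      induction k with
      | zero => simpa using hw
      | succ k ih =>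
        refine ⟨?_, ?_⟩
        · have := ih.2
          simp only [mem_ofPred_eq, add_sub_cancel_left] at this ⊢
          rw [pow_succ', mul_assoc, Complex.I_mul_re, abs_neg]
          exact this
        · have := ih.1
          simp only [mem_ofPred_eq, add_sub_cancel_left] at this ⊢
          rw [pow_succ', mul_assoc, Complex.I_mul_im]
          exact this
    have hrotU : ∀ w ∈ U, ∀ k : ℕ, z + Complex.I ^ k * (w - z) ∈ U := by
      intro w hw k
      induction k with
      | zero => simpa using hw
      | succ k ih =>
        refine ⟨?_, ?_⟩
        · have := ih.2
          simp only [mem_ofPred_eq, add_sub_cancel_left] at this ⊢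
          rw [pow_succ', mul_assoc, Complex.I_mul_re, abs_neg]
          exact this
        · have := ih.1
          simp only [mem_ofPred_eq, add_sub_cancel_left] at this ⊢
          rw [pow_succ', mul_assoc, Complex.I_mul_im]
          exact this
    have hCball : C ⊆ Metric.ball 0 r ∩ {w | 0 ≤ w.im} := by
      intro w hw
      refine ⟨?_, ?_⟩
      · rw [mem_ball_zero_iff]
        calc ‖w‖ = ‖(w - z) + z‖ := by simp
          _ ≤ ‖w - z‖ + ‖z‖ := norm_add_le _ _
          _ < r := by linarith [hCn w hw]
      · have := (abs_le.1 (hC₂ w hw)).1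
        simp only [Complex.sub_im] at this
        simp only [mem_ofPred_eq]
        linarith
    have hUball : U ⊆ Metric.ball 0 r ∩ {w | 0 < w.im} := by
      intro w hw
      refine ⟨(hCball (hUsub hw)).1, ?_⟩
      have := (abs_lt.1 (hU₂ w hw)).1
      simp only [Complex.sub_im] at this
      simp only [mem_ofPred_eq]
      linarith
    let P : ℂ → ℂ := fun w => ∏ k ∈ Finset.range 4, F (z + Complex.I ^ k * (w - z))
    have hPd : DiffContOnCl ℂ P U := by
      refine ⟨?_, ?_⟩
      · refine DifferentiableOn.fun_finsetProd fun k _ => ?_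
        exact hd.comp (f := fun w => z + Complex.I ^ k * (w - z)) (by fun_prop)
          fun w hw => hUball (hrotU w hw k)
      · refine continuousOn_finsetProd _ fun k _ => ?_
        exact hc.comp (f := fun w => z + Complex.I ^ k * (w - z)) (by fun_prop)
          fun w hw => hCball (hrotC w (hUC hw) k)
    have hzero : EqOn P (fun _ => 0) (frontier U) := by
      intro w hw
      rw [hUo.frontier_eq] at hw
      have hwC := hUC hw.1
      -- Some quarter-turn moves the side containing w to the bottom.
      have key : ∃ k ∈ Finset.range 4, (Complex.I ^ k * (w - z)).im = -y := by
        have hor : |(w - z).re| = y ∨ |(w - z).im| = y := by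
          by_contra hcon
          rw [not_or] at hcon
          exact hw.2 ⟨lt_of_le_of_ne (hC₁ w hwC) hcon.1, lt_of_le_of_ne (hC₂ w hwC) hcon.2⟩
        have hI3 : Complex.I ^ 3 = -Complex.I := by
          rw [pow_succ, Complex.I_sq]; ring
        rcases hor with h | h
        · rcases (abs_eq hy.le).1 h with h | h
          · exact ⟨3, by simp, by rw [hI3, neg_mul, Complex.neg_im, Complex.I_mul_im, h]⟩
          · exact ⟨1, by simp, by simpa using h⟩
        · rcases (abs_eq hy.le).1 h with h | h
          · exact ⟨2, by simp, by rw [Complex.I_sq]; rw [← h]; simp⟩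
          · exact ⟨0, by simp, by simpa using h⟩
      obtain ⟨k, hk, hk'⟩ := key
      refine Finset.prod_eq_zero hk (h0 _ (hCball (hrotC w hwC k)).1 ?_)
      rw [Complex.add_im, hk', ← hydef, add_neg_cancel]
    have hUb : Bornology.IsBounded U :=
      (Metric.isBounded_closedBall (x := z) (r := 2 * y)).subset fun w (hw : w ∈ U) => by
        rw [mem_closedBall_iff_norm]; exact hCn w (hUsub hw)
    have h := Complex.eqOn_of_eqOn_frontier hUb hPd diffContOnCl_const hzero
      (show z ∈ U by simp [U, hy])
    simpa [P] using h
  have han : AnalyticOnNhd ℂ F (Metric.ball 0 r ∩ {w | 0 < w.im}) := hd.analyticOnNhd hopen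
  have hpre : IsPreconnected (Metric.ball (0 : ℂ) r ∩ {w | 0 < w.im}) :=
    ((convex_ball 0 r).inter (convex_halfSpace_im_gt 0)).isPreconnected
  have hz : ((r / 8 : ℝ) : ℂ) * Complex.I ∈ Metric.ball (0 : ℂ) r ∩ {w | 0 < w.im} := by
    refine ⟨?_, ?_⟩
    · rw [mem_ball_zero_iff, norm_mul, Complex.norm_I, mul_one, Complex.norm_of_nonneg (by positivity)]
      linarith
    · simp only [mem_ofPred_eq, Complex.mul_im, Complex.ofReal_re, Complex.I_im, Complex.ofReal_im]
      linarith
  have hev : F =ᶠ[𝓝 (((r / 8 : ℝ) : ℂ) * Complex.I)] 0 := by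
    have hn : ‖((r / 8 : ℝ) : ℂ) * Complex.I‖ < r / 4 := by
      rw [norm_mul, Complex.norm_I, mul_one, Complex.norm_of_nonneg (by positivity)]
      linarith
    filter_upwards [hopen.mem_nhds hz, continuous_norm.continuousAt.eventually_lt_const hn]
      with w hw hw'
    exact hsmall w hw' hw.2
  intro w hw hy
  exact han.eqOn_zero_of_preconnected_of_eventuallyEq_zero hpre hz hev ⟨hw, hy⟩

/-! ### Geometry of the reflected segment -/

/-- The segment joining `skew τ (Γ w)` (at `s = 0`) to the value at `w` of the holomorphic function
`w ↦ Γ w - τ * conj (Γ (conj w))` (at `s = 1`), which agrees with `skew τ ∘ Γ` on the real line. -/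
noncomputable def reflSegment (τ : ℝ) (Γ : ℂ → ℂ) (w : ℂ) (s : ℝ) : ℂ :=
  skew τ (Γ w) + s * τ * conj (Γ w - Γ (conj w))

/-- The segment `reflSegment τ Γ w` stays in the image of the upper half disc, at distance
comparable to `w.im` from the complement. -/
lemma exists_closedBall_reflSegment_subset {τ : ℝ} (hτ : τ ∈ Ico (0 : ℝ) 1) {Γ : ℂ → ℂ} {b : ℂ}
    (hΓ : HasStrictDerivAt Γ b 0) (hb : b ≠ 0) {r : ℝ} (hr : 0 < r) :
    ∃ r₁ > 0, ∃ c > 0, ∃ K > 0, r₁ ≤ r ∧ ∀ w ∈ Metric.ball (0 : ℂ) r₁, 0 < w.im →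
      ∀ s ∈ Icc (0 : ℝ) 1, ∀ u ∈ Metric.closedBall (reflSegment τ Γ w s) (c * w.im),
        ∃ ζ ∈ Metric.ball (0 : ℂ) r, 0 < ζ.im ∧ ‖ζ - w‖ ≤ K * w.im ∧ skew τ (Γ ζ) = u := by
  obtain ⟨hτ0, hτ1⟩ := id hτ
  obtain ⟨κ, hκ⟩ : ∃ κ, κ = 1 - τ := ⟨_, rfl⟩
  have hκ0 : 0 < κ := by linarith
  have hκ1 : κ ≤ 1 := by linarith
  have hB : 0 < ‖b‖ := norm_pos_iff.2 hb
  -- Linearization tolerance: since ‖v‖ ≤ 2y/κ below, the cube leaves an error e‖v‖ of order κ²‖b‖y,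
  -- the size of the target ball.
  obtain ⟨e, he⟩ : ∃ e, e = κ ^ 3 * ‖b‖ / 100 := ⟨_, rfl⟩
  have he0 : 0 < e := by rw [he]; positivity
  let Γ' : ℂ →L[ℝ] ℂ := b • ContinuousLinearMap.id ℝ ℂ
  have hΓ' : HasStrictFDerivAt Γ Γ' 0 := hΓ.complexToReal_fderiv
  have hM : HasStrictFDerivAt (fun w => skew τ (Γ w)) ((skew τ).comp Γ') 0 :=
    (skew τ).hasStrictFDerivAt.comp 0 hΓ'
  let e' : NNReal := ⟨e, he0.le⟩
  obtain ⟨s₁, hs₁, hA₁⟩ := hΓ'.approximates_deriv_on_nhds (c := e') (Or.inr he0)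
  obtain ⟨s₂, hs₂, hA₂⟩ := hM.approximates_deriv_on_nhds (c := e') (Or.inr he0)
  obtain ⟨r₀, hr₀, hsub⟩ := Metric.mem_nhds_iff.1 (inter_mem (inter_mem hs₁ hs₂) (Metric.ball_mem_nhds 0 hr))
  let inv : ((skew τ).comp Γ').NonlinearRightInverse :=
    { toFun := fun u => skewInv τ u / b
      nnnorm := ⟨(κ * ‖b‖)⁻¹, by positivity⟩
      bound' := fun u => by
        rw [norm_div]
        refine (div_le_div_of_nonneg_right (norm_skewInv_le hτ u) hB.le).trans (le_of_eq ?_)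
        rw [← hκ]
        change _ = (κ * ‖b‖)⁻¹ * ‖u‖
        field_simp
      right_inv' := fun u => by
        simp only [ContinuousLinearMap.comp_apply, Γ', smul_apply,
          ContinuousLinearMap.id_apply, smul_eq_mul]
        rw [mul_div_cancel₀ _ hb, skew_skewInv hτ] }
  refine ⟨min (r₀ / (1 + 3 / κ)) r, by positivity, κ ^ 2 * ‖b‖ / 10, by positivity, 3 / κ, by positivity,
    min_le_right _ _, ?_⟩
  intro w hw hy s hs u hu
  obtain ⟨y, hydef⟩ : ∃ y, y = w.im := ⟨_, rfl⟩
  rw [← hydef] at hy hu ⊢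
  have hyw : y ≤ ‖w‖ := hydef ▸ (le_abs_self _).trans (Complex.abs_im_le_norm w)
  rw [mem_ball_zero_iff, lt_min_iff, lt_div_iff₀ (by positivity)] at hw
  replace hw := hw.1
  have hball : ∀ z : ℂ, ‖z - w‖ ≤ 3 / κ * y → z ∈ Metric.ball (0 : ℂ) r₀ := by
    intro z hz
    rw [mem_ball_zero_iff]
    have : 3 / κ * y ≤ 3 / κ * ‖w‖ := by gcongr
    calc ‖z‖ = ‖(z - w) + w‖ := by simp
      _ ≤ ‖z - w‖ + ‖w‖ := norm_add_le _ _
      _ < r₀ := by linarith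
  have hK3 : 3 ≤ 3 / κ := by rw [le_div_iff₀ hκ0]; linarith
  have hwc : w - conj w = 2 * Complex.I * y := by
    rw [hydef]; apply Complex.ext <;> simp
    ring
  -- The shift of w that, to first order, moves `skew τ (Γ w)` to `reflSegment τ Γ w s`.
  obtain ⟨v, hv⟩ : ∃ v, v = skewInv τ (s * τ * conj (b * (2 * Complex.I * y))) / b := ⟨_, rfl⟩
  have hvn : ‖v‖ ≤ 2 * y / κ := by
    have h1 := norm_skewInv_le hτ (s * τ * conj (b * (2 * Complex.I * y)))
    have h2 : ‖(s * τ * conj (b * (2 * Complex.I * y)) : ℂ)‖ ≤ ‖b‖ * (2 * y) := by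
      rw [norm_mul, RCLike.norm_conj, norm_mul, norm_mul b, norm_mul (2 * Complex.I), norm_mul 2,
        Complex.norm_of_nonneg hs.1, Complex.norm_of_nonneg hτ0, Complex.norm_of_nonneg hy.le,
        Complex.norm_I, Complex.norm_ofNat, mul_one]
      have : s * τ ≤ 1 := by nlinarith [hs.1, hs.2]
      have h3 : 0 ≤ ‖b‖ * (2 * y) := by positivity
      nlinarith
    rw [hv, norm_div, div_le_iff₀ hB]
    calc _ ≤ (1 - τ)⁻¹ * (‖b‖ * (2 * y)) :=
          h1.trans (mul_le_mul_of_nonneg_left h2 (by rw [← hκ]; positivity))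
      _ = _ := by rw [← hκ]; field_simp
  -- The decisive inequality: the shift lowers the height by at most 2τy/(1 + τ) ≤ (1 + τ)y/2, so w
  -- + v keeps height at least κy/2.
  have hvim : - (1 - κ / 2) * y ≤ v.im := by
    have h1 : v = ((2 * y * s * τ / (1 - τ ^ 2) : ℝ) : ℂ) * (Complex.I * (τ - conj b / b)) := by
      have := one_sub_sq_ne_zero_of_mem_Ico hτ
      rw [hv, skewInv_apply]
      simp only [map_mul, Complex.conj_ofReal, Complex.conj_conj, Complex.conj_I, map_neg, Complex.conj_ofNat]
      push_cast
      field_simp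
      ring
    have h2 : (conj b / b).re ≤ 1 := by
      refine (Complex.re_le_norm _).trans ?_
      rw [norm_div, RCLike.norm_conj, div_self hB.ne']
    rw [h1, Complex.im_ofReal_mul, Complex.I_mul_im, Complex.sub_re, Complex.ofReal_re]
    have h3 : 0 < 1 - τ ^ 2 := by nlinarith
    have h4 : 0 ≤ 2 * y * s * τ / (1 - τ ^ 2) := by
      have := hs.1; positivity
    have h5 : 2 * y * s * τ / (1 - τ ^ 2) * (1 - τ) ≤ (1 - κ / 2) * y := by
      rw [div_mul_eq_mul_div, div_le_iff₀ h3, hκ]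
      have h6 : s * τ ≤ τ := by nlinarith [hs.2]
      have h7 : 4 * τ ≤ (1 + τ) ^ 2 := by nlinarith [sq_nonneg (1 - τ)]
      have h8 : 0 ≤ y * (1 - τ) := mul_nonneg hy.le (by linarith)
      calc 2 * y * s * τ * (1 - τ) = (y * (1 - τ)) * (2 * (s * τ)) := by ring
        _ ≤ (y * (1 - τ)) * ((1 + τ) ^ 2 / 2) := by gcongr; linarith
        _ = _ := by ring
    have h6 := mul_le_mul_of_nonneg_left (sub_le_sub_left h2 τ) h4
    linarith
  have hw0 : w ∈ Metric.ball (0 : ℂ) r₀ := hball w (by simp; positivity)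
  have hcw : conj w ∈ Metric.ball (0 : ℂ) r₀ := by
    rw [mem_ball_zero_iff, RCLike.norm_conj]; simpa using hw0
  have hvw : w + v ∈ Metric.ball (0 : ℂ) r₀ := hball _ (by
    rw [add_sub_cancel_left]
    refine hvn.trans ?_
    rw [div_mul_eq_mul_div]; gcongr; norm_num)
  have hδ : ∀ z ∈ Metric.closedBall (w + v) (κ / 4 * y), ‖z - w‖ ≤ 3 / κ * y := by
    intro z hz
    rw [mem_closedBall_iff_norm] at hz
    have h1 : κ / 4 ≤ 1 / κ := by
      rw [div_le_div_iff₀ (by norm_num) hκ0]; nlinarith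
    calc ‖z - w‖ = ‖(z - (w + v)) + v‖ := by congr 1; ring
      _ ≤ ‖z - (w + v)‖ + ‖v‖ := norm_add_le _ _
      _ ≤ 1 / κ * y + 2 * y / κ := by
        have := mul_le_mul_of_nonneg_right h1 hy.le
        linarith
      _ = _ := by ring
  -- Quantitative inverse function theorem on a ball of radius κy/4 about w + v, which stays in the
  -- upper half plane.
  have hsurj := hA₂.surjOn_closedBall_of_nonlinearRightInverse inv (b := w + v)
    (ε := κ / 4 * y) (by positivity) (fun z hz => (hsub (hball z (hδ z hz))).1.2)
  have hN : ((inv.nnnorm : ℝ)⁻¹ - e') = κ * ‖b‖ - e := by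
    change ((κ * ‖b‖)⁻¹)⁻¹ - e = _
    rw [inv_inv]
  rw [hN] at hsurj
  have hE₁ : ‖Γ w - Γ (conj w) - b * (2 * Complex.I * y)‖ ≤ e * (2 * y) := by
    have := hA₁ w (hsub hw0).1.1 (conj w) (hsub hcw).1.1
    rw [hwc] at this
    have h2 : ‖2 * Complex.I * (y : ℂ)‖ = 2 * y := by simp [abs_of_pos hy]
    rw [h2] at this
    exact this
  have hE₂ : ‖skew τ (Γ (w + v)) - skew τ (Γ w) - s * τ * conj (b * (2 * Complex.I * y))‖ ≤
      e * ‖v‖ := by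
    have := hA₂ (w + v) (hsub hvw).1.2 w (hsub hw0).1.2
    rw [add_sub_cancel_left] at this
    have h2 : ((skew τ).comp Γ') v = s * τ * conj (b * (2 * Complex.I * y)) := by
      rw [hv]; exact inv.right_inv' _
    rw [h2] at this
    exact this
  -- In units of κ²‖b‖y: the left side is at most 1/10 + 1/50 + 1/50, the right side at least 1/4 -
  -- 1/100.
  have hclose : ‖u - skew τ (Γ (w + v))‖ ≤ (κ * ‖b‖ - e) * (κ / 4 * y) := by
    rw [mem_closedBall_iff_norm] at hu
    have hst : ‖(s * τ : ℂ)‖ ≤ 1 := by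
      rw [norm_mul, Complex.norm_of_nonneg hs.1, Complex.norm_of_nonneg hτ0]
      nlinarith [hs.1, hs.2]
    have e1 : u - skew τ (Γ (w + v)) = (u - reflSegment τ Γ w s) -
        (skew τ (Γ (w + v)) - skew τ (Γ w) - s * τ * conj (b * (2 * Complex.I * y))) +
        s * τ * conj (Γ w - Γ (conj w) - b * (2 * Complex.I * y)) := by
      rw [reflSegment]; simp only [map_sub]; ring
    have e2 : ‖s * τ * conj (Γ w - Γ (conj w) - b * (2 * Complex.I * y))‖ ≤ e * (2 * y) := by
      rw [norm_mul, RCLike.norm_conj]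
      calc _ ≤ 1 * (e * (2 * y)) := by gcongr
        _ = _ := one_mul _
    rw [e1]
    refine ((norm_add_le _ _).trans (add_le_add_left (norm_sub_le _ _) _)).trans ?_
    have e3 : e * ‖v‖ ≤ κ ^ 2 * ‖b‖ / 50 * y := by
      calc e * ‖v‖ ≤ e * (2 * y / κ) := by gcongr
        _ = _ := by rw [he]; field_simp; ring
    have e4 : e ≤ κ ^ 2 * ‖b‖ / 100 := by
      rw [he]; gcongr ?_ * _ / _; nlinarith [sq_nonneg κ]
    have e5 : e * (2 * y) ≤ κ ^ 2 * ‖b‖ / 100 * (2 * y) := by gcongr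
    have e6 : e * (κ / 4 * y) ≤ κ ^ 2 * ‖b‖ / 100 * (1 * y) := by
      gcongr; linarith
    have e7 : 0 ≤ κ ^ 2 * ‖b‖ * y := by positivity
    nlinarith
  obtain ⟨ζ, hζ, hζu⟩ := hsurj (by rw [mem_closedBall_iff_norm]; exact hclose)
  refine ⟨ζ, (hsub (hball ζ (hδ ζ hζ))).2, ?_, hδ ζ hζ, hζu⟩
  rw [mem_closedBall_iff_norm] at hζ
  have h1 := (abs_le.1 ((Complex.abs_im_le_norm _).trans hζ)).1
  simp only [Complex.sub_im, Complex.add_im] at h1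
  nlinarith

/-! ### Holomorphic extension of the boundary values -/

/-- For a solution `f` of `𝓛_τ f = 0` near an analytic arc parametrized by `Γ`, a holomorphic
function of the parameter with the same boundary values as `f ∘ Γ` on the real line. -/
noncomputable def reflExt (τ : ℝ) (f Γ : ℂ → ℂ) (w : ℂ) : ℂ :=
  f (Γ w) - conj (Γ w - Γ (conj w)) *
    ∫ s in (0 : ℝ)..1, dbar f (skewInv τ (reflSegment τ Γ w s))

lemma reflExt_of_im_eq_zero (τ : ℝ) (f Γ : ℂ → ℂ) {w : ℂ} (hw : w.im = 0) :
    reflExt τ f Γ w = f (Γ w) := by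
  have : conj w = w := Complex.conj_eq_iff_im.2 hw
  simp [reflExt, this]

lemma differentiableAt_conj_comp_conj {Γ : ℂ → ℂ} {w : ℂ}
    (h : DifferentiableAt ℂ Γ (conj w)) : DifferentiableAt ℂ (fun w => conj (Γ (conj w))) w := by
  have := h.conj_conj
  rw [Complex.conj_conj] at this
  exact this

/-- With a primitive Q of q, the integral becomes a difference of values of Q. The ∂̄-derivative of
τ⁻¹Q(z - τz̄) is -q, which cancels that of f. -/
lemma differentiableAt_reflExt_of_ne_zero {τ : ℝ} (hτ : τ ∈ Ico (0 : ℝ) 1) (hτ0 : τ ≠ 0)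
    {f Γ : ℂ → ℂ}
    {G : Set ℂ} (hG : IsOpen G) (hf : IsLAnalyticOn (LTau τ) f G) {w₀ : ℂ}
    (hΓ : DifferentiableAt ℂ Γ w₀) (hΓ' : DifferentiableAt ℂ Γ (conj w₀))
    (hseg : ∀ s ∈ Icc (0 : ℝ) 1, skewInv τ (reflSegment τ Γ w₀ s) ∈ G) :
    DifferentiableAt ℂ (reflExt τ f Γ) w₀ := by
  have hτc : (τ : ℂ) ≠ 0 := by exact_mod_cast hτ0
  let Φ : ℂ → ℂ := fun w => Γ w - τ * conj (Γ (conj w))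
  have hΦd : DifferentiableAt ℂ Φ w₀ := hΓ.sub ((differentiableAt_conj_comp_conj hΓ').const_mul _)
  have hMc : ContinuousAt (fun w => skew τ (Γ w)) w₀ :=
    (skew τ).continuous.continuousAt.comp hΓ.continuousAt
  have hreflΦ : ∀ w, reflSegment τ Γ w 1 = Φ w := fun w => by
    simp only [reflSegment, skew_apply, Φ, map_sub]; push_cast; ring
  have hrefl : ∀ (w : ℂ) (s : ℝ),
      reflSegment τ Γ w s = AffineMap.lineMap (skew τ (Γ w)) (Φ w) s := fun w s => by
    rw [AffineMap.lineMap_apply]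
    simp only [reflSegment, skew_apply, Φ, map_sub, vsub_eq_sub, vadd_eq_add, Complex.real_smul]
    ring
  have hK : segment ℝ (skew τ (Γ w₀)) (Φ w₀) ⊆ skewInv τ ⁻¹' G := by
    rw [segment_eq_image_lineMap]
    rintro _ ⟨s, hs, rfl⟩
    rw [← hrefl]
    exact hseg s hs
  have hKc : IsCompact (segment ℝ (skew τ (Γ w₀)) (Φ w₀)) := by
    rw [segment_eq_image_lineMap]
    exact isCompact_Icc.image (by fun_prop)
  obtain ⟨δ, hδ, hW⟩ := hKc.exists_thickening_subset_open
    (hG.preimage (skewInv τ).continuous) hK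
  -- A thickened segment is convex, so q has a primitive on it and nearby segments stay inside.
  set W := Metric.thickening δ (segment ℝ (skew τ (Γ w₀)) (Φ w₀)) with hWdef
  have hWo : IsOpen W := Metric.isOpen_thickening
  have hWconv : Convex ℝ W := (convex_segment _ _).thickening δ
  have hKW : segment ℝ (skew τ (Γ w₀)) (Φ w₀) ⊆ W := Metric.self_subset_thickening hδ _
  have hqd : ∀ u ∈ W, DifferentiableAt ℂ (fun u => dbar f (skewInv τ u)) u := fun u hu =>
    hf.differentiableAt_dbar_comp_skewInv hG (hW hu)
  obtain ⟨Q, hQ'⟩ := hWconv.exists_forall_hasDerivWithinAt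
    (fun u hu => (hqd u hu).differentiableWithinAt)
  have hQ : ∀ u ∈ W, HasDerivAt Q (dbar f (skewInv τ u)) u := fun u hu =>
    (hQ' u hu).hasDerivAt (hWo.mem_nhds hu)
  have hMW : skew τ (Γ w₀) ∈ W := hKW (left_mem_segment ℝ _ _)
  have hΦW : Φ w₀ ∈ W := hKW (right_mem_segment ℝ _ _)
  have hev : reflExt τ f Γ =ᶠ[𝓝 w₀]
      fun w => (f (Γ w) + (τ : ℂ)⁻¹ * Q (skew τ (Γ w))) - (τ : ℂ)⁻¹ * Q (Φ w) := by
    filter_upwards [hMc.eventually (hWo.mem_nhds hMW),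
      hΦd.continuousAt.eventually (hWo.mem_nhds hΦW)] with w hw1 hw2
    have hin : ∀ s ∈ uIcc (0 : ℝ) 1, reflSegment τ Γ w s ∈ W := by
      intro s hs
      rw [uIcc_of_le zero_le_one] at hs
      rw [hrefl]
      exact hWconv.lineMap_mem hw1 hw2 hs
    have hd : ∀ s ∈ uIcc (0 : ℝ) 1, HasDerivAt (fun s : ℝ => Q (reflSegment τ Γ w s))
        (dbar f (skewInv τ (reflSegment τ Γ w s)) * (τ * conj (Γ w - Γ (conj w)))) s := by
      intro s hs
      have h1 : HasDerivAt (fun s : ℝ => reflSegment τ Γ w s)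
          (τ * conj (Γ w - Γ (conj w))) s := by
        have := ((((hasDerivAt_id (s : ℂ)).comp_ofReal).mul_const
          (τ * conj (Γ w - Γ (conj w)))).const_add (skew τ (Γ w)))
        simpa [reflSegment, mul_assoc] using this
      exact (hQ _ (hin s hs)).comp s h1
    have hcont : ContinuousOn (fun s : ℝ => dbar f (skewInv τ (reflSegment τ Γ w s)))
        (uIcc 0 1) := by
      have h1 : ContinuousOn (fun u => dbar f (skewInv τ u)) W :=
        fun u hu => (hqd u hu).continuousAt.continuousWithinAt
      refine h1.comp (f := fun s => reflSegment τ Γ w s) ?_ hin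
      simp only [reflSegment]
      fun_prop
    have hint := intervalIntegral.integral_eq_sub_of_hasDerivAt hd
      (hcont.mul continuousOn_const).intervalIntegrable
    rw [intervalIntegral.integral_mul_const, hreflΦ] at hint
    have h0 : reflSegment τ Γ w 0 = skew τ (Γ w) := by simp [reflSegment]
    rw [h0] at hint
    rw [reflExt]
    field_simp
    linear_combination -hint
  refine DifferentiableAt.congr_of_eventuallyEq ?_ hev
  refine DifferentiableAt.sub ?_ (((hQ _ hΦW).differentiableAt.comp w₀ hΦd).const_mul _)
  have hΓ0 : Γ w₀ ∈ G := by
    have := hseg 0 (by simp)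
    simpa [reflSegment, skewInv_skew hτ] using this
  have hfd : HasFDerivAt f (fderiv ℝ f (Γ w₀)) (Γ w₀) :=
    ((hf.1.contDiffAt (hG.mem_nhds hΓ0)).differentiableAt (by norm_num)).hasFDerivAt
  have hΓr := hΓ.hasDerivAt.complexToReal_fderiv
  have hQr := (hQ _ hMW).complexToReal_fderiv
  have htot := (hfd.comp w₀ hΓr).add
    ((hQr.comp w₀ ((skew τ).hasFDerivAt.comp w₀ hΓr)).const_mul ((τ : ℂ)⁻¹))
  refine (htot.hasDerivAt_of_forall_eq_mul (c := (del f (Γ w₀) + (τ : ℂ)⁻¹ * dbar f (Γ w₀)) *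
    deriv Γ w₀) fun v => ?_).differentiableAt
  simp only [add_apply, ContinuousLinearMap.comp_apply,
    smul_apply, one_apply_eq_self, smul_eq_mul, skewInv_skew hτ,
    skew_apply τ (_ * _), fderiv_eq_del_mul_add_dbar_mul_conj]
  field_simp
  ring

/-- For τ = 0 the integrand does not depend on s, and ∂̄f and f - z̄ ∂̄f are both holomorphic. -/
lemma differentiableAt_reflExt_zero {f Γ : ℂ → ℂ}
    {G : Set ℂ} (hG : IsOpen G) (hf : IsLAnalyticOn (LTau (0 : ℝ)) f G) {w₀ : ℂ}
    (hΓ : DifferentiableAt ℂ Γ w₀) (hΓ' : DifferentiableAt ℂ Γ (conj w₀)) (hΓ0 : Γ w₀ ∈ G) :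
    DifferentiableAt ℂ (reflExt 0 f Γ) w₀ := by
  have hinv : ∀ u, skewInv 0 u = u := fun u => by simp [skewInv_apply]
  have heq : reflExt 0 f Γ = fun w => (f (Γ w) - conj (Γ w) * dbar f (Γ w)) +
      conj (Γ (conj w)) * dbar f (Γ w) := by
    ext w
    simp only [reflExt, hinv, reflSegment, skew_apply]
    simp
    ring
  have hp : DifferentiableAt ℂ (dbar f) (Γ w₀) := by
    have := hf.differentiableAt_dbar_comp_skewInv hG (u := Γ w₀) (by rwa [hinv])
    simpa only [hinv] using this
  have hpΓ : DifferentiableAt ℂ (fun w => dbar f (Γ w)) w₀ := hp.comp w₀ hΓ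
  rw [heq]
  refine DifferentiableAt.add ?_ ((differentiableAt_conj_comp_conj hΓ').mul hpΓ)
  have hfd : HasFDerivAt f (fderiv ℝ f (Γ w₀)) (Γ w₀) :=
    ((hf.1.contDiffAt (hG.mem_nhds hΓ0)).differentiableAt (by norm_num)).hasFDerivAt
  have hΓr := hΓ.hasDerivAt.complexToReal_fderiv
  have hpr := hpΓ.hasDerivAt.complexToReal_fderiv
  have hcr := (Complex.conjCLE : ℂ →L[ℝ] ℂ).hasFDerivAt.comp w₀ hΓr
  have htot := (hfd.comp w₀ hΓr).sub (hcr.mul hpr)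
  refine (htot.hasDerivAt_of_forall_eq_mul (c := del f (Γ w₀) * deriv Γ w₀ -
    conj (Γ w₀) * deriv (fun w => dbar f (Γ w)) w₀) fun v => ?_).differentiableAt
  simp [fderiv_eq_del_mul_add_dbar_mul_conj]
  ring

/-- The function `reflExt τ f Γ` is holomorphic where it is defined. -/
lemma IsLAnalyticOn.differentiableAt_reflExt {τ : ℝ} (hτ : τ ∈ Ico (0 : ℝ) 1) {f Γ : ℂ → ℂ}
    {G : Set ℂ} (hG : IsOpen G) (hf : IsLAnalyticOn (LTau τ) f G) {w₀ : ℂ}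
    (hΓ : DifferentiableAt ℂ Γ w₀) (hΓ' : DifferentiableAt ℂ Γ (conj w₀))
    (hseg : ∀ s ∈ Icc (0 : ℝ) 1, skewInv τ (reflSegment τ Γ w₀ s) ∈ G) :
    DifferentiableAt ℂ (reflExt τ f Γ) w₀ := by
  rcases eq_or_ne τ 0 with rfl | h
  · refine differentiableAt_reflExt_zero hG hf hΓ hΓ' ?_
    have := hseg 0 (by simp)
    simpa [reflSegment, skewInv_skew hτ] using this
  · exact differentiableAt_reflExt_of_ne_zero hτ h hG hf hΓ hΓ' hseg

/-! ### The contradiction in a chart -/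

/-- Near a point of an analytic arc in the boundary of `G`, the function `1 / (z - a)` with
`a ∈ G` on one side of the arc does not extend from the arc to a solution on that side. -/
lemma exists_radius_forall_not_boundary_value {τ : ℝ} (hτ : τ ∈ Ico (0 : ℝ) 1) {Γ : ℂ → ℂ} {r : ℝ}
    (hr : 0 < r) (hΓ : DifferentiableOn ℂ Γ (Metric.ball 0 r)) (hΓ0 : deriv Γ 0 ≠ 0) :
    ∃ r₁ > 0, r₁ ≤ r ∧ ∀ (G : Set ℂ) (f : ℂ → ℂ) (w₀ : ℂ), IsOpen G →
      (∀ w ∈ Metric.ball (0 : ℂ) r, 0 < w.im → Γ w ∈ G) →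
      (∀ w ∈ Metric.ball (0 : ℂ) r, w.im = 0 → Γ w ∈ frontier G) →
      ContinuousOn f (closure G) → IsLAnalyticOn (LTau τ) f G →
      (∀ z ∈ frontier G, f z = 1 / (z - Γ w₀)) →
      w₀ ∈ Metric.ball (0 : ℂ) r₁ → ¬ 0 < w₀.im := by
  have hdiff : ∀ w ∈ Metric.ball (0 : ℂ) r, DifferentiableAt ℂ Γ w := fun w hw =>
    hΓ.differentiableAt (Metric.isOpen_ball.mem_nhds hw)
  have hstrict : HasStrictDerivAt Γ (deriv Γ 0) 0 :=
    (hΓ.analyticAt (Metric.ball_mem_nhds 0 hr)).hasStrictDerivAt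
  obtain ⟨k, t, ht, hlip⟩ := hstrict.hasStrictFDerivAt.exists_lipschitzOnWith
  obtain ⟨r₂, hr₂, hr₂t⟩ := Metric.mem_nhds_iff.1 ht
  obtain ⟨r₁, hr₁, c, hc, K, hK, hr₁r, hgeo⟩ :=
    exists_closedBall_reflSegment_subset hτ hstrict hΓ0 (lt_min hr hr₂)
  have hr₁r' : r₁ ≤ r := hr₁r.trans (min_le_left _ _)
  have hr₁r₂ : r₁ ≤ r₂ := hr₁r.trans (min_le_right _ _)
  -- The radius depends on Γ and τ only, so one neighbourhood serves every pole and every candidate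
  -- f.
  refine ⟨r₁, hr₁, hr₁r', ?_⟩
  intro G f w₀ hG hside hfront hfc hf hfb hw₀ hy₀
  have hcl : ∀ w ∈ Metric.ball (0 : ℂ) r, 0 ≤ w.im → Γ w ∈ closure G := by
    intro w hw hy
    rcases hy.eq_or_lt with h | h
    · exact frontier_subset_closure (hfront w hw h.symm)
    · exact subset_closure (hside w hw h)
  have hsub : Metric.ball (0 : ℂ) r₁ ⊆ Metric.ball 0 r := Metric.ball_subset_ball hr₁r'
  have hconj : ∀ w ∈ Metric.ball (0 : ℂ) r₁, conj w ∈ Metric.ball (0 : ℂ) r₁ := by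
    intro w hw; simpa using hw
  have hnear : ∀ w ∈ Metric.ball (0 : ℂ) r₁, 0 < w.im → ∀ s ∈ Icc (0 : ℝ) 1,
      ∀ u ∈ Metric.closedBall (reflSegment τ Γ w s) (c * w.im),
      ∃ ζ ∈ Metric.ball (0 : ℂ) r, 0 < ζ.im ∧ ‖ζ - w‖ ≤ K * w.im ∧ skewInv τ u = Γ ζ := by
    intro w hw hy s hs u hu
    obtain ⟨ζ, hζ, hζy, hζw, rfl⟩ := hgeo w hw hy s hs u hu
    exact ⟨ζ, Metric.ball_subset_ball (min_le_left _ _) hζ, hζy, hζw, skewInv_skew hτ _⟩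
  have hin : ∀ w ∈ Metric.ball (0 : ℂ) r₁, 0 < w.im → ∀ s ∈ Icc (0 : ℝ) 1,
      ∀ u ∈ Metric.closedBall (reflSegment τ Γ w s) (c * w.im), skewInv τ u ∈ G := by
    intro w hw hy s hs u hu
    obtain ⟨ζ, hζ, hζy, -, h⟩ := hnear w hw hy s hs u hu
    exact h ▸ hside ζ hζ hζy
  have hFd : ∀ w ∈ Metric.ball (0 : ℂ) r₁, 0 < w.im → DifferentiableAt ℂ (reflExt τ f Γ) w := by
    intro w hw hy
    refine hf.differentiableAt_reflExt hτ hG (hdiff w (hsub hw)) (hdiff _ (hsub (hconj w hw)))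
      fun s hs => hin w hw hy s hs _ (Metric.mem_closedBall_self (by positivity))
  have hfΓ : ContinuousOn (fun w => f (Γ w)) (Metric.ball 0 r ∩ {w | 0 ≤ w.im}) :=
    hfc.comp (hΓ.continuousOn.mono inter_subset_left) fun w hw => hcl w hw.1 hw.2
  -- On the diameter: the reflection gap is O(Im w) and ∂̄f is O(η / Im w), so Im w cancels and the
  -- correction is O(η).
  have hFc : ContinuousOn (reflExt τ f Γ) (Metric.ball 0 r₁ ∩ {w | 0 ≤ w.im}) := by
    rintro x ⟨hx, hxy⟩
    rcases (show 0 ≤ x.im from hxy).eq_or_lt with h | h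
    swap
    · exact (hFd x hx h).continuousAt.continuousWithinAt
    rw [Metric.continuousWithinAt_iff]
    intro ε hε
    obtain ⟨η, hη, hηε⟩ : ∃ η > 0, 2 * k / c * (2 * η) + η < ε := by
      have h1 : 0 < 4 * k / c + 1 := by positivity
      refine ⟨ε / (2 * (4 * k / c + 1)), by positivity, ?_⟩
      have : 2 * k / c * (2 * (ε / (2 * (4 * k / c + 1)))) + ε / (2 * (4 * k / c + 1)) = ε / 2 := by
        field_simp
        ring
      linarith
    obtain ⟨δ, hδ, hδη⟩ := Metric.continuousWithinAt_iff.1 (hfΓ x ⟨hsub hx, hxy⟩) η hη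
    refine ⟨δ / (1 + K), by positivity, ?_⟩
    rintro w ⟨hw, hwy⟩ hwx
    rw [reflExt_of_im_eq_zero _ _ _ h.symm]
    rw [lt_div_iff₀ (by positivity)] at hwx
    have hwδ : dist w x < δ := lt_of_le_of_lt (by nlinarith [dist_nonneg (x := w) (y := x)]) hwx
    have h1 : dist (f (Γ w)) (f (Γ x)) < η := hδη ⟨hsub hw, hwy⟩ hwδ
    rcases (show 0 ≤ w.im from hwy).eq_or_lt with h' | hy
    · rw [reflExt_of_im_eq_zero _ _ _ h'.symm]
      have : 0 ≤ 2 * k / c * (2 * η) := by positivity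
      linarith
    have hyx : w.im ≤ dist w x := by
      have := (le_abs_self _).trans (Complex.abs_im_le_norm (w - x))
      rw [Complex.sub_im, ← h, sub_zero] at this
      rwa [dist_eq_norm]
    have hq : ∀ s ∈ Icc (0 : ℝ) 1,
        ‖dbar f (skewInv τ (reflSegment τ Γ w s))‖ ≤ 2 * η / (c * w.im) := by
      intro s hs
      rw [le_div_iff₀ (by positivity)]
      refine hf.norm_dbar_mul_le hτ hG (by positivity) (hin w hw hy s hs) (κ := f (Γ x)) ?_
      intro u hu
      obtain ⟨ζ, hζ, hζy, hζw, hζu⟩ := hnear w hw hy s hs u hu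
      rw [hζu, ← dist_eq_norm]
      refine (hδη ⟨hζ, show 0 ≤ ζ.im from hζy.le⟩ ?_).le
      calc dist ζ x ≤ dist ζ w + dist w x := dist_triangle _ _ _
        _ ≤ K * dist w x + dist w x := by
          rw [dist_eq_norm ζ w]
          have := mul_le_mul_of_nonneg_left hyx hK.le
          linarith
        _ < δ := by linarith
    have hint : ‖∫ s in (0 : ℝ)..1, dbar f (skewInv τ (reflSegment τ Γ w s))‖ ≤
        2 * η / (c * w.im) := by
      have := intervalIntegral.norm_integral_le_of_norm_le_const (a := (0 : ℝ)) (b := 1)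
        (f := fun s => dbar f (skewInv τ (reflSegment τ Γ w s))) (C := 2 * η / (c * w.im))
        fun s hs => hq s (by
          rw [uIoc_of_le zero_le_one] at hs; exact Ioc_subset_Icc_self hs)
      simpa using this
    have hΓw : ‖Γ w - Γ (conj w)‖ ≤ k * (2 * w.im) := by
      have h2 := hlip.norm_sub_le (hr₂t (Metric.ball_subset_ball hr₁r₂ hw))
        (hr₂t (Metric.ball_subset_ball hr₁r₂ (hconj w hw)))
      have h3 : w - conj w = 2 * Complex.I * w.im := by
        apply Complex.ext <;> simp
        ring
      rw [h3] at h2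
      simpa [abs_of_pos hy] using h2
    have h2 : dist (reflExt τ f Γ w) (f (Γ w)) ≤ 2 * k / c * (2 * η) := by
      rw [dist_eq_norm, reflExt, sub_sub_cancel_left, norm_neg, norm_mul, RCLike.norm_conj]
      calc _ ≤ k * (2 * w.im) * (2 * η / (c * w.im)) := by gcongr
        _ = _ := by field_simp
    linarith [dist_triangle (reflExt τ f Γ w) (f (Γ w)) (f (Γ x))]
  -- Multiplying by Γ(w) - Γ(w₀) avoids the pole; the resulting function is -1 at w₀.
  have hH := eqOn_zero_of_continuousOn_halfDisc (r := r₁) hr₁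
    (F := fun w => reflExt τ f Γ w * (Γ w - Γ w₀) - 1)
    (fun w hw => ((hFd w hw.1 hw.2).mul ((hdiff w (hsub hw.1)).sub_const _)).sub_const _
      |>.differentiableWithinAt)
    ((hFc.mul ((hΓ.continuousOn.mono fun w hw => hsub hw.1).sub continuousOn_const)).sub
      continuousOn_const)
    (fun w hw hy => by
      have hne : Γ w - Γ w₀ ≠ 0 := by
        intro h0
        have h1 := hfront w (hsub hw) hy
        rw [sub_eq_zero.1 h0, hG.frontier_eq] at h1
        exact h1.2 (hside w₀ (hsub hw₀) hy₀)
      rw [reflExt_of_im_eq_zero _ _ _ hy, hfb _ (hfront w (hsub hw) hy), one_div,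
        inv_mul_cancel₀ hne, sub_self])
    w₀ hw₀ hy₀
  simp at hH

/-! ### Conformal charts along the arc -/

/-- A real-analytic function of a real variable extends to a holomorphic function. -/
lemma AnalyticAt.exists_complex_extension {γ : ℝ → ℂ} {t₀ : ℝ} (hγ : AnalyticAt ℝ γ t₀) :
    ∃ Γ : ℂ → ℂ, AnalyticAt ℂ Γ 0 ∧ ∀ᶠ t : ℝ in 𝓝 0, Γ t = γ (t₀ + t) := by
  obtain ⟨p, hp⟩ := hγ
  -- The same coefficients read over ℂ; equal norms give a positive radius of convergence.
  let P : FormalMultilinearSeries ℂ ℂ ℂ := fun n =>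
    ContinuousMultilinearMap.mkPiRing ℂ (Fin n) (p.coeff n)
  have hcoeff : ∀ n, P.coeff n = p.coeff n := fun n => by
    rw [FormalMultilinearSeries.coeff, ContinuousMultilinearMap.mkPiRing_apply]
    simp
  have hnorm : ∀ n, ‖P n‖ = ‖p n‖ := fun n => by
    rw [FormalMultilinearSeries.norm_apply_eq_norm_coef,
      FormalMultilinearSeries.norm_apply_eq_norm_coef, hcoeff]
  have hrad : 0 < P.radius := by
    obtain ⟨ρ, hρ0, hρ⟩ := ENNReal.lt_iff_exists_nnreal_btwn.1 hp.radius_pos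
    obtain ⟨C, -, hC⟩ := p.norm_mul_pow_le_of_lt_radius hρ
    exact lt_of_lt_of_le hρ0 (P.le_radius_of_bound C fun n => by rw [hnorm]; exact hC n)
  have hP : HasFPowerSeriesAt P.sum P 0 := ⟨_, P.hasFPowerSeriesOnBall hrad⟩
  refine ⟨P.sum, ⟨P, hP⟩, ?_⟩
  have h1 := hasFPowerSeriesAt_iff.1 hp
  have h2 := (Complex.continuous_ofReal.tendsto' 0 0 Complex.ofReal_zero).eventually
    (hasFPowerSeriesAt_iff.1 hP)
  filter_upwards [h1, h2] with t ht1 ht2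
  rw [zero_add] at ht2
  refine ht2.unique ?_
  simpa [hcoeff] using ht1

/-- Near a point of an analytic arc isolated from the rest of the boundary, the boundary is the
image of the real line under a conformal chart. -/
lemma IsAnalyticArc.exists_chart {A S : Set ℂ} (hA : IsAnalyticArc A) (hAS : A ⊆ S)
    (hAcc : ∀ z ∈ A, ¬ AccPt z (𝓟 (S \ A))) {p : ℂ} (hp : p ∈ A) :
    ∃ (Γ : ℂ → ℂ) (r : ℝ), 0 < r ∧ DifferentiableOn ℂ Γ (Metric.ball 0 r) ∧ Γ 0 = p ∧
      deriv Γ 0 ≠ 0 ∧ ∀ w ∈ Metric.ball (0 : ℂ) r, Γ w ∈ S ↔ w.im = 0 := by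
  obtain ⟨γ, hγ, hγ', hemb, rfl⟩ := hA
  obtain ⟨t₀, ht₀, rfl⟩ := id hp
  obtain ⟨Γ, hΓ, hext⟩ := (hγ t₀ ht₀).exists_complex_extension
  have hΓ0 : Γ 0 = γ t₀ := by simpa using hext.self_of_nhds
  have hderiv : deriv Γ 0 = deriv γ t₀ := by
    have h0 : HasDerivAt Γ (deriv Γ 0) ((0 : ℝ) : ℂ) := by
      simpa using hΓ.differentiableAt.hasDerivAt
    have h1 : HasDerivAt (fun t : ℝ => γ (t₀ + t)) (deriv Γ 0) 0 :=
      h0.comp_ofReal.congr_of_eventuallyEq (hext.mono fun t ht => ht.symm)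
    have h2 : HasDerivAt (fun t : ℝ => γ (t₀ + t)) (deriv γ t₀) 0 := by
      have h3 : HasDerivAt γ (deriv γ t₀) (t₀ + 0) := by
        simpa using (hγ t₀ ht₀).differentiableAt.hasDerivAt
      exact HasDerivAt.comp_const_add t₀ 0 h3
    exact h1.unique h2
  have hd0 : deriv Γ 0 ≠ 0 := hderiv ▸ hγ' t₀ ht₀
  have hinv := (hΓ.hasStrictDerivAt.hasStrictFDerivAt_equiv hd0).eventually_left_inverse
  have hreal : ∀ᶠ t : ℝ in 𝓝 0, Γ t = γ (t₀ + t) ∧ t₀ + t ∈ Ioo (0 : ℝ) 1 := by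
    refine hext.and ?_
    have : Tendsto (fun t : ℝ => t₀ + t) (𝓝 0) (𝓝 t₀) := by
      simpa using (continuous_const_add t₀).tendsto 0
    exact this.eventually (Ioo_mem_nhds ht₀.1 ht₀.2)
  obtain ⟨r₁, hr₁, h₁⟩ := Metric.eventually_nhds_iff_ball.1 (hinv.and hΓ.eventually_analyticAt)
  obtain ⟨r₂, hr₂, h₂⟩ := Metric.eventually_nhds_iff_ball.1 hreal
  have hr : 0 < min r₁ r₂ := lt_min hr₁ hr₂
  -- The embedding hypothesis prevents distant parameters from returning near γ(t₀); local
  -- injectivity of Γ then forces w to be real.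
  have hO : ∃ O ∈ 𝓝 (γ t₀), ∀ t ∈ Ioo (0 : ℝ) 1, γ t ∈ O → |t - t₀| < min r₁ r₂ := by
    have h3 : {x : Ioo (0 : ℝ) 1 | |(x : ℝ) - t₀| < min r₁ r₂} ∈ 𝓝 (⟨t₀, ht₀⟩ : Ioo (0 : ℝ) 1) := by
      have h4 : Continuous fun x : Ioo (0 : ℝ) 1 => |(x : ℝ) - t₀| := by fun_prop
      exact h4.continuousAt.eventually_lt_const (by simpa using hr)
    rw [hemb.nhds_eq_comap] at h3
    obtain ⟨O, hO, hO'⟩ := mem_comap.1 h3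
    exact ⟨O, hO, fun t ht htO => hO' (show (⟨t, ht⟩ : Ioo (0 : ℝ) 1) ∈ _ from htO)⟩
  obtain ⟨O, hO, hO'⟩ := hO
  obtain ⟨O₂, hO₂, hO₂'⟩ : ∃ O₂ ∈ 𝓝 (γ t₀), ∀ z ∈ O₂, z ∈ S → z ∈ γ '' Ioo 0 1 := by
    have h3 := hAcc _ hp
    rw [accPt_iff_nhds] at h3
    push Not at h3
    obtain ⟨U, hU, hU'⟩ := h3
    refine ⟨U, hU, fun z hz hzS => ?_⟩
    by_contra hzA
    exact hzA (hU' z ⟨hz, hzS, hzA⟩ ▸ hp)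
  have hcont : ∀ᶠ w in 𝓝 (0 : ℂ), Γ w ∈ O ∩ O₂ :=
    hΓ.continuousAt.eventually (hΓ0 ▸ inter_mem hO hO₂)
  obtain ⟨r₃, hr₃, h₃⟩ := Metric.eventually_nhds_iff_ball.1 hcont
  refine ⟨Γ, min (min r₁ r₂) r₃, lt_min hr hr₃, fun w hw => ?_, hΓ0, hd0, fun w hw => ⟨fun h => ?_,
    fun h => ?_⟩⟩
  · exact (h₁ w (Metric.ball_subset_ball ((min_le_left _ _).trans (min_le_left _ _)) hw)).2
      |>.differentiableAt.differentiableWithinAt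
  · have hw₁ := Metric.ball_subset_ball ((min_le_left _ _).trans (min_le_left _ _)) hw
    have hw₃ := h₃ w (Metric.ball_subset_ball (min_le_right _ _) hw)
    obtain ⟨t, ht, htw⟩ := hO₂' _ hw₃.2 h
    have htr := hO' t ht (htw ▸ hw₃.1)
    have ht₁ : ((t - t₀ : ℝ) : ℂ) ∈ Metric.ball (0 : ℂ) r₁ := by
      rw [mem_ball_zero_iff, Complex.norm_real]
      exact htr.trans_le (min_le_left _ _)
    have ht₂ : t - t₀ ∈ Metric.ball (0 : ℝ) r₂ := by
      rw [mem_ball_zero_iff]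
      exact htr.trans_le (min_le_right _ _)
    have h4 : Γ ((t - t₀ : ℝ) : ℂ) = Γ w := by
      rw [(h₂ _ ht₂).1, ← htw]; congr 1; ring
    have h5 : ((t - t₀ : ℝ) : ℂ) = w := by
      rw [← (h₁ _ ht₁).1, ← (h₁ _ hw₁).1, h4]
    rw [← h5, Complex.ofReal_im]
  · have hwr : w = (w.re : ℂ) := Complex.ext rfl (by simpa using h)
    have hw₂ : w.re ∈ Metric.ball (0 : ℝ) r₂ := by
      rw [mem_ball_zero_iff]
      refine lt_of_le_of_lt (Complex.abs_re_le_norm w) ?_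
      exact mem_ball_zero_iff.1
        (Metric.ball_subset_ball ((min_le_left _ _).trans (min_le_right _ _)) hw)
    rw [hwr, (h₂ _ hw₂).1]
    exact hAS (mem_image_of_mem _ (h₂ _ hw₂).2)

/-- The chart maps the upper half disc into `G` as soon as it maps one of its points there. -/
lemma forall_mem_of_chart {G : Set ℂ} (hG : IsOpen G) {Γ : ℂ → ℂ} {r : ℝ}
    (hΓ : ContinuousOn Γ (Metric.ball 0 r))
    (hfront : ∀ w ∈ Metric.ball (0 : ℂ) r, Γ w ∈ frontier G ↔ w.im = 0) {w₀ : ℂ}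
    (hw₀ : w₀ ∈ Metric.ball (0 : ℂ) r) (hy₀ : 0 < w₀.im) (hG₀ : Γ w₀ ∈ G) :
    ∀ w ∈ Metric.ball (0 : ℂ) r, 0 < w.im → Γ w ∈ G := by
  have hpre : IsPreconnected (Γ '' (Metric.ball (0 : ℂ) r ∩ {w | 0 < w.im})) :=
    ((convex_ball 0 r).inter (convex_halfSpace_im_gt 0)).isPreconnected.image _
      (hΓ.mono inter_subset_left)
  -- The image of the half disc misses the frontier, so by connectedness it cannot leave G.
  have hsub : Γ '' (Metric.ball (0 : ℂ) r ∩ {w | 0 < w.im}) ⊆ G ∪ (closure G)ᶜ := by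
    rintro _ ⟨w, ⟨hw, hy⟩, rfl⟩
    by_contra hcon
    rw [mem_union, not_or, notMem_compl_iff] at hcon
    have : Γ w ∈ frontier G := by rw [hG.frontier_eq]; exact ⟨hcon.2, hcon.1⟩
    exact (ne_of_gt (show 0 < w.im from hy)) ((hfront w hw).1 this)
  have h := hpre.subset_left_of_subset_union hG isClosed_closure.isOpen_compl
    (disjoint_compl_right.mono_left subset_closure) hsub
    ⟨_, mem_image_of_mem _ ⟨hw₀, hy₀⟩, hG₀⟩
  exact fun w hw hy => h (mem_image_of_mem _ ⟨hw, hy⟩)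

/-! ### Local and global conclusions -/

/-- The domain may lie on either or both sides of the arc. The charts Γ(w) and Γ(-w) treat poles
above and below the real axis. -/
lemma exists_nhds_forall_not_dirichletSolvable {G A : Set ℂ} (hG : IsOpen G)
    (hA : IsAnalyticArc A) (hAG : A ⊆ frontier G)
    (hAcc : ∀ z ∈ A, ¬ AccPt z (𝓟 (frontier G \ A))) {τ : ℝ} (hτ : τ ∈ Ico (0 : ℝ) 1)
    {p : ℂ} (hp : p ∈ A) :
    ∃ V ∈ 𝓝 p, ∀ a ∈ G ∩ V, ¬ DirichletSolvable (LTau τ) G (fun z => 1 / (z - a)) := by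
  obtain ⟨Γ, r, hr, hΓ, rfl, hd0, hfront⟩ := hA.exists_chart hAG hAcc hp
  have hneg : ∀ w ∈ Metric.ball (0 : ℂ) r, -w ∈ Metric.ball (0 : ℂ) r := fun w hw => by
    simpa using hw
  have hΓn : DifferentiableOn ℂ (fun w => Γ (-w)) (Metric.ball 0 r) :=
    hΓ.comp (f := fun w => -w) (by fun_prop) hneg
  have hdn0 : deriv (fun w => Γ (-w)) 0 ≠ 0 := by
    rw [deriv_comp_neg, neg_zero]; exact neg_ne_zero.2 hd0
  have hfrontn : ∀ w ∈ Metric.ball (0 : ℂ) r, Γ (-w) ∈ frontier G ↔ w.im = 0 := fun w hw => by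
    rw [hfront _ (hneg w hw), Complex.neg_im, neg_eq_zero]
  obtain ⟨r₁, hr₁, hr₁r, h₁⟩ := exists_radius_forall_not_boundary_value hτ hr hΓ hd0
  obtain ⟨r₂, hr₂, hr₂r, h₂⟩ := exists_radius_forall_not_boundary_value hτ hr hΓn hdn0
  have hstrict : HasStrictDerivAt Γ (deriv Γ 0) 0 :=
    (hΓ.analyticAt (Metric.ball_mem_nhds 0 hr)).hasStrictDerivAt
  refine ⟨Γ '' Metric.ball 0 (min r₁ r₂), ?_, ?_⟩
  · rw [← hstrict.map_nhds_eq hd0]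
    exact image_mem_map (Metric.ball_mem_nhds 0 (lt_min hr₁ hr₂))
  rintro _ ⟨haG, w₀, hw₀, rfl⟩ ⟨f, hfc, hf, hfb⟩
  have hw₁ : w₀ ∈ Metric.ball (0 : ℂ) r₁ := Metric.ball_subset_ball (min_le_left _ _) hw₀
  have hw₂ : -w₀ ∈ Metric.ball (0 : ℂ) r₂ := by
    simpa using Metric.ball_subset_ball (min_le_right r₁ r₂) hw₀
  have hwr := Metric.ball_subset_ball hr₁r hw₁
  rcases lt_trichotomy w₀.im 0 with hy | hy | hy
  · have hy' : 0 < (-w₀).im := by simpa using hy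
    exact h₂ G f (-w₀) hG
      (forall_mem_of_chart hG hΓn.continuousOn hfrontn (hneg _ hwr) hy' (by simpa using haG))
      (fun w hw => (hfrontn w hw).2) hfc hf (by simpa using hfb) hw₂ hy'
  · have h := (hfront _ hwr).2 hy
    rw [hG.frontier_eq] at h
    exact h.2 haG
  · exact h₁ G f w₀ hG (forall_mem_of_chart hG hΓ.continuousOn hfront hwr hy haG)
      (fun w hw => (hfront w hw).2) hfc hf hfb hw₁ hy

theorem mainTheorem7 (G : Set ℂ) (hGo : IsOpen G) (hGb : Bornology.IsBounded G)
    (hGs : IsSimplyConnected G) (A : Set ℂ) (hA : IsAnalyticArc A)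
    (hAG : A ⊆ frontier G) (hAcc : ∀ z ∈ A, ¬ AccPt z (𝓟 (frontier G \ A)))
    (τ : ℝ) (hτ : τ ∈ Ico (0 : ℝ) 1) :
    ¬ IsLRegular (LTau τ) G ∧
      ∃ V : Set ℂ, IsOpen V ∧ A ⊆ V ∧
        ∀ a ∈ G ∩ V, ¬ DirichletSolvable (LTau τ) G (fun z => 1 / (z - a)) := by
  have hV : ∃ V : Set ℂ, IsOpen V ∧ A ⊆ V ∧
      ∀ a ∈ G ∩ V, ¬ DirichletSolvable (LTau τ) G (fun z => 1 / (z - a)) := by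
    choose! V hVp hV using fun (p : ℂ) (hp : p ∈ A) =>
      exists_nhds_forall_not_dirichletSolvable hGo hA hAG hAcc hτ hp
    refine ⟨⋃ p ∈ A, interior (V p), isOpen_biUnion fun p _ => isOpen_interior,
      fun p hp => mem_biUnion hp (mem_interior_iff_mem_nhds.2 (hVp p hp)), ?_⟩
    rintro a ⟨haG, ha⟩
    obtain ⟨p, hp, hap⟩ := mem_iUnion₂.1 ha
    exact hV p hp a ⟨haG, interior_subset hap⟩
  refine ⟨fun hreg => ?_, hV⟩
  obtain ⟨V, hVo, hAV, hVs⟩ := hV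
  obtain ⟨p, hp⟩ : A.Nonempty := by
    obtain ⟨γ, -, -, -, rfl⟩ := hA
    exact ⟨γ (1 / 2), mem_image_of_mem _ (by norm_num)⟩
  -- Arc points are limits of G, so an admissible pole exists; 1/(z - a) is continuous on the
  -- frontier because a lies in the open set G.
  obtain ⟨a, haV, haG⟩ := mem_closure_iff.1 (frontier_subset_closure (hAG hp)) V hVo (hAV hp)
  refine hVs a ⟨haG, haV⟩ (hreg _ ?_)
  refine continuousOn_const.div (by fun_prop) fun z hz h0 => ?_
  rw [sub_eq_zero.1 h0, hGo.frontier_eq] at hz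
  exact hz.2 haG
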